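/- Let $R$ be a commutative noetherian ring and let $\mathfrak p$ be a prime ideal of $R$. Let $\mathsf D^f(R)$ be the full subcategory of the derived category of $R$-modules consisting of the complexes $X$ whose total cohomology $\bigoplus_{i\in\mathbb Z}H^i(X)$ is a finitely generated $R$-module, let $\mathsf{perf}(R)\subseteq\mathsf D^f(R)$ be the full subcategory of the complexes isomorphic (in the derived category) to a bounded complex of finitely generated projective $R$-modules, and let $\mathsf D_{\mathsf{sg}}(R)=\mathsf D^f(R)/\mathsf{perf}(R)$ be the Verdier quotient, an $R$-linear triangulated category. Let $\lambda\colon \mathsf D_{\mathsf{sg}}(R)\to\mathsf D_{\mathsf{sg}}(R_{\mathfrak p})$, $X\mapsto X_{\mathfrak p}$, be the triangle functor induced by localization of modules. For an $R$-linear triangulated category $\mathcal T$, put $\mathcal T_{Z(\mathfrak p)}=\{X\in\mathcal T\mid \operatorname{Hom}_{\mathcal T}(X,X)_{\mathfrak q}=0\text{ for all primes }\mathfrak q\subseteq\mathfrak p\}$ and $\mathcal T_{\mathfrak p}=\mathcal T/\mathcal T_{Z(\mathfrak p)}$ (Verdier quotient). Then the following hold. 1. $\mathsf D_{\mathsf{sg}}(R)_{Z(\mathfrak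 p)}=\{X\in \mathsf D_{\mathsf{sg}}(R)\mid X_{\mathfrak p}=0\text{ in }\mathsf D_{\mathsf{sg}}(R_{\mathfrak p})\}$. Consequently $\mathsf D_{\mathsf{sg}}(R)_{\mathfrak p}=\mathsf D_{\mathsf{sg}}(R)/\{X\mid X_{\mathfrak p}=0\text{ in }\mathsf D_{\mathsf{sg}}(R_{\mathfrak p})\}$. 2. There is a triangle equivalence $\mathsf D_{\mathsf{sg}}(R)_{\mathfrak p}\cong\mathsf D_{\mathsf{sg}}(R_{\mathfrak p})$ whose composite with the quotient functor $\mathsf D_{\mathsf{sg}}(R)\to\mathsf D_{\mathsf{sg}}(R)_{\mathfrak p}$ is isomorphic to $\lambda$, compatibly with the shifts. 3. For all $X,Y\in\mathsf D_{\mathsf{sg}}(R)$ there is an isomorphism of $R_{\mathfrak p}$-modules $$\operatorname{Hom}_{\mathsf D_{\mathsf{sg}}(R)}(X,Y)_{\mathfrak p}\cong\operatorname{Hom}_{\mathsf D_{\mathsf{sg}}(R_{\mathfrak p})}(X_{\mathfrak p},Y_{\mathfrak p}),\qquad f/s\mapsto \tfrac1s\,\lambda(f)\quad(s\notin\mathfrak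 p),$$ which is therefore natural in $X$ and $Y$. -/

import Mathlib

open CategoryTheory Limits Pretriangulated ZeroObject
open scoped DirectSum

universe w w₁ w₂ v u

namespace SingularityCategory

section VerdierQuotient

variable {C : Type u} [Category.{v} C] [HasZeroObject C] [HasShift C ℤ] [Preadditive C]
  [∀ n : ℤ, (shiftFunctor C n).Additive] [Pretriangulated C] [IsTriangulated C]

/-- The Verdier quotient `C / P` of a triangulated category by a triangulated subcategory: the
localization of `C` at the class of morphisms whose cone lies in `P`. -/
def VerdierQuotient (P : ObjectProperty C) [P.IsTriangulated] : Type u :=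
  P.trW.Localization

namespace VerdierQuotient

variable (P : ObjectProperty C) [P.IsTriangulated]

noncomputable instance : Category (VerdierQuotient P) :=
  inferInstanceAs (Category P.trW.Localization)

noncomputable instance : Preadditive (VerdierQuotient P) :=
  inferInstanceAs (Preadditive P.trW.Localization)

instance : HasZeroObject (VerdierQuotient P) :=
  inferInstanceAs (HasZeroObject P.trW.Localization)

noncomputable instance : HasShift (VerdierQuotient P) ℤ :=
  inferInstanceAs (HasShift P.trW.Localization ℤ)

instance (n : ℤ) : (shiftFunctor (VerdierQuotient P) n).Additive :=
  inferInstanceAs (shiftFunctor P.trW.Localization n).Additive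

noncomputable instance : Pretriangulated (VerdierQuotient P) :=
  inferInstanceAs (Pretriangulated P.trW.Localization)

instance : IsTriangulated (VerdierQuotient P) :=
  inferInstanceAs (IsTriangulated P.trW.Localization)

/-- The quotient functor `C ⥤ C / P`. -/
noncomputable def quotientFunctor : C ⥤ VerdierQuotient P := P.trW.Q

instance : (quotientFunctor P).IsLocalization P.trW :=
  inferInstanceAs (P.trW.Q.IsLocalization P.trW)

noncomputable instance : (quotientFunctor P).CommShift ℤ :=
  inferInstanceAs (P.trW.Q.CommShift ℤ)

instance : (quotientFunctor P).Additive := inferInstanceAs P.trW.Q.Additive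

instance : (quotientFunctor P).IsTriangulated :=
  Triangulated.Localization.isTriangulated_functor P.trW.Q P.trW

variable (R : Type w) [CommRing R] [Linear R C]

noncomputable instance : Linear R (VerdierQuotient P) :=
  inferInstanceAs (Linear R P.trW.Localization)

instance : (quotientFunctor P).Linear R := inferInstanceAs (P.trW.Q.Linear R)

instance [∀ n : ℤ, (shiftFunctor C n).Linear R] (n : ℤ) :
    (shiftFunctor (VerdierQuotient P) n).Linear R :=
  inferInstanceAs ((shiftFunctor P.trW.Localization n).Linear R)

end VerdierQuotient

end VerdierQuotient

section Support

lemma subsingleton_localizedModule_end_iff {R : Type w} [CommRing R] {C : Type u} [Category.{v} C]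
    [Preadditive C] [Linear R C] (S : Submonoid R) (X : C) :
    Subsingleton (LocalizedModule S (X ⟶ X)) ↔ ∃ r ∈ S, r • 𝟙 X = 0 := by
  rw [LocalizedModule.subsingleton_iff]
  refine ⟨fun h => h (𝟙 X), fun ⟨r, hr, h⟩ f => ⟨r, hr, ?_⟩⟩
  rw [← Category.id_comp f, ← Linear.smul_comp, h, Limits.zero_comp]

variable (R : Type w) [CommRing R]
  (C : Type u) [Category.{v} C] [HasZeroObject C] [HasShift C ℤ] [Preadditive C]
  [∀ n : ℤ, (shiftFunctor C n).Additive] [Pretriangulated C] [IsTriangulated C]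
  [Linear R C] [∀ n : ℤ, (shiftFunctor C n).Linear R]

/-- For an `R`-linear triangulated category `C` and `V ⊆ Spec R`, the full subcategory `C_V` of the
objects `X` such that `Hom(X, X)_q = 0` for all primes `q ∉ V`. -/
def supportedOn (V : Set (PrimeSpectrum R)) : ObjectProperty C := fun X =>
  ∀ q : PrimeSpectrum R, q ∉ V → Subsingleton (LocalizedModule q.asIdeal.primeCompl (X ⟶ X))

instance supportedOn_isTriangulated (V : Set (PrimeSpectrum R)) :
    (supportedOn R C V).IsTriangulated where
  exists_zero := ⟨0, isZero_zero C, fun q _ => by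
    rw [subsingleton_localizedModule_end_iff]
    exact ⟨1, one_mem _, (isZero_zero C).eq_of_src _ _⟩⟩
  isStableUnderShiftBy n := ⟨fun X hX q hq => by
    have h := hX q hq
    rw [subsingleton_localizedModule_end_iff] at h ⊢
    obtain ⟨r, hr, h⟩ := h
    exact ⟨r, hr, by rw [← (shiftFunctor C n).map_id, ← Functor.map_smul, h, Functor.map_zero]⟩⟩
  ext₂' T hT h₁ h₃ := ObjectProperty.le_isoClosure _ _ fun q hq => by
    have h₁ := h₁ q hq
    have h₃ := h₃ q hq
    rw [subsingleton_localizedModule_end_iff] at h₁ h₃ ⊢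
    obtain ⟨r, hr, h₁⟩ := h₁
    obtain ⟨s, hs, h₃⟩ := h₃
    obtain ⟨g, hg⟩ := Triangle.coyoneda_exact₂ T hT (s • 𝟙 T.obj₂) (by
      rw [Linear.smul_comp, Category.id_comp, ← Category.comp_id T.mor₂, ← Linear.comp_smul, h₃,
        Limits.comp_zero])
    refine ⟨r * s, mul_mem hr hs, ?_⟩
    rw [mul_smul, hg, ← Linear.comp_smul, ← Category.id_comp T.mor₁, ← Linear.smul_comp, h₁,
      Limits.zero_comp, Limits.comp_zero]

variable {R}

/-- The set `Z(p)` of the primes of `R` that are not contained in `p`. -/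
def primesNotContainedIn (p : Ideal R) : Set (PrimeSpectrum R) := {q | ¬ q.asIdeal ≤ p}

/-- The localization `C_p = C / C_{Z(p)}` of an `R`-linear triangulated category `C` at `p`. -/
abbrev LocalizationAt (p : Ideal R) : Type u :=
  VerdierQuotient (supportedOn R C (primesNotContainedIn p))

end Support

section Df

variable (R : Type u) [CommRing R] [HasDerivedCategory.{w} (ModuleCat.{u} R)]

/-- The complexes whose total cohomology `⨁ᵢ Hⁱ(X)` is a finitely generated `R`-module. -/
def finiteCohomology : ObjectProperty (DerivedCategory (ModuleCat.{u} R)) := fun X =>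
  Module.Finite R (⨁ i : ℤ, ((DerivedCategory.homologyFunctor (ModuleCat.{u} R) i).obj X))

/-- The complexes isomorphic, in the derived category, to a bounded complex of finitely generated
projective `R`-modules. -/
def perfect : ObjectProperty (DerivedCategory (ModuleCat.{u} R)) := fun X =>
  ∃ K : CochainComplex (ModuleCat.{u} R) ℤ,
    (∃ a b : ℤ, K.IsStrictlyGE a ∧ K.IsStrictlyLE b) ∧
    (∀ i : ℤ, Module.Finite R (K.X i) ∧ Module.Projective R (K.X i)) ∧
    Nonempty (X ≅ DerivedCategory.Q.obj K)

lemma finite_directSum_iff {ι : Type} [DecidableEq ι] (R : Type u) [Ring R]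
    (M : ι → Type u)
    [∀ i, AddCommGroup (M i)] [∀ i, Module R (M i)] :
    Module.Finite R (⨁ i, M i) ↔
      (∀ i, Module.Finite R (M i)) ∧ {i : ι | Nontrivial (M i)}.Finite := by
  constructor
  · intro h
    refine ⟨fun i => Module.Finite.of_surjective (DirectSum.component R ι M i) fun m =>
      ⟨DirectSum.lof R ι M i m, DirectSum.component.lof_self ..⟩, ?_⟩
    obtain ⟨s, hs⟩ := h.fg_top
    classical
    refine (s.biUnion fun x => DFinsupp.support x).finite_toSet.subset
      fun i (hi : Nontrivial (M i)) => ?_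
    obtain ⟨m, hm⟩ := exists_ne (0 : M i)
    by_contra hi'
    apply hm
    have : Submodule.span R (s : Set (⨁ i, M i)) ≤ LinearMap.ker (DirectSum.component R ι M i) := by
      rw [Submodule.span_le]
      intro x hx
      by_contra hx'
      exact hi' (Finset.mem_coe.2 (Finset.mem_biUnion.2 ⟨x, hx, DFinsupp.mem_support_iff.2 hx'⟩))
    rw [hs] at this
    have := this (x := DirectSum.lof R ι M i m) trivial
    rwa [LinearMap.mem_ker, DirectSum.component.lof_self] at this
  · rintro ⟨h, hs⟩
    classical
    have := hs.to_subtype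
    have : Fintype {i : ι | Nontrivial (M i)} := Fintype.ofFinite _
    refine Module.Finite.of_surjective
      (∑ i : {i : ι | Nontrivial (M i)}, (DirectSum.lof R ι M i).comp (LinearMap.proj i) :
        (∀ i : {i : ι | Nontrivial (M i)}, M i) →ₗ[R] (⨁ i, M i)) ?_
    rw [← LinearMap.range_eq_top, eq_top_iff]
    rintro x -
    induction x using DirectSum.induction_on with
    | zero => exact zero_mem _
    | add x y hx hy => exact add_mem hx hy
    | of i m =>
      by_cases hi : Nontrivial (M i)
      · refine ⟨Pi.single (⟨i, hi⟩ : {i : ι | Nontrivial (M i)}) m, ?_⟩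
        rw [LinearMap.sum_apply, Finset.sum_eq_single (⟨i, hi⟩ : {i : ι | Nontrivial (M i)})]
        · simp [DirectSum.lof_eq_of]
        · intro j _ hj
          simp [Pi.single_eq_of_ne hj]
        · simp
      · rw [not_nontrivial_iff_subsingleton] at hi
        rw [Subsingleton.elim m 0, map_zero]
        exact zero_mem _

lemma finite_of_exact {R : Type u} [CommRing R] [IsNoetherianRing R] {M N P : Type u}
    [AddCommGroup M] [AddCommGroup N] [AddCommGroup P] [Module R M] [Module R N] [Module R P]
    (f : M →ₗ[R] N) (g : N →ₗ[R] P) (h : Function.Exact f g) [Module.Finite R M]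
    [Module.Finite R P] : Module.Finite R N := by
  refine ⟨Submodule.fg_of_fg_map_of_fg_inf_ker g (IsNoetherian.noetherian _) ?_⟩
  rw [top_inf_eq, LinearMap.exact_iff.1 h, LinearMap.range_eq_map]
  exact Module.Finite.fg_top.map f

lemma subsingleton_of_exact {R : Type u} [CommRing R] {M N P : Type u}
    [AddCommGroup M] [AddCommGroup N] [AddCommGroup P] [Module R M] [Module R N] [Module R P]
    (f : M →ₗ[R] N) (g : N →ₗ[R] P) (h : Function.Exact f g) [Subsingleton M]
    [Subsingleton P] : Subsingleton N := by
  refine subsingleton_of_forall_eq 0 fun a => ?_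
  obtain ⟨c, rfl⟩ := (h a).1 (Subsingleton.elim _ _)
  rw [Subsingleton.elim c 0, map_zero]

lemma finiteCohomology_iff (X : DerivedCategory (ModuleCat.{u} R)) :
    finiteCohomology R X ↔
      (∀ i : ℤ, Module.Finite R ((DerivedCategory.homologyFunctor (ModuleCat.{u} R) i).obj X)) ∧
      {i : ℤ | Nontrivial ((DerivedCategory.homologyFunctor (ModuleCat.{u} R) i).obj X)}.Finite :=
  finite_directSum_iff R _

instance [IsNoetherianRing R] : (finiteCohomology R).IsTriangulated where
  exists_zero := ⟨0, isZero_zero _, by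
    rw [finiteCohomology_iff]
    have (i : ℤ) : Subsingleton
        ((DerivedCategory.homologyFunctor (ModuleCat.{u} R) i).obj 0) :=
      ModuleCat.subsingleton_of_isZero (Functor.map_isZero _ (isZero_zero _))
    refine ⟨fun i => inferInstance, ?_⟩
    convert Set.finite_empty
    ext i
    simpa [not_nontrivial_iff_subsingleton] using this i⟩
  isStableUnderShiftBy n := ⟨fun X hX => by
    rw [ObjectProperty.prop_shift_iff]
    rw [finiteCohomology_iff] at hX ⊢
    have e (i : ℤ) : ((DerivedCategory.homologyFunctor (ModuleCat.{u} R) i).obj (X⟦n⟧)) ≃ₗ[R]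
        ((DerivedCategory.homologyFunctor (ModuleCat.{u} R) (n + i)).obj X) :=
      (((DerivedCategory.homologyFunctor (ModuleCat.{u} R) 0).shiftIso n i (n + i) rfl).app X).toLinearEquiv
    refine ⟨fun i => ?_, ?_⟩
    · have := hX.1 (n + i)
      exact Module.Finite.equiv (e i).symm
    · refine (hX.2.preimage (f := fun i => n + i) (fun _ _ _ _ => by simp)).subset ?_
      intro i hi
      have : Nontrivial ((DerivedCategory.homologyFunctor (ModuleCat.{u} R) i).obj (X⟦n⟧)) := hi
      exact (e i).symm.toEquiv.nontrivial⟩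
  ext₂' T hT h₁ h₃ := ObjectProperty.le_isoClosure _ _ <| by
    rw [finiteCohomology_iff] at h₁ h₃ ⊢
    have ex := fun i : ℤ => (ShortComplex.ShortExact.moduleCat_exact_iff_function_exact _).1
      ((DerivedCategory.homologyFunctor (ModuleCat.{u} R) i).map_distinguished_exact T hT)
    refine ⟨fun i => ?_, ?_⟩
    · exact @finite_of_exact R _ _ _ _ _ _ _ _ _ _ _ _ _ (ex i) (h₁.1 i) (h₃.1 i)
    · refine (h₁.2.union h₃.2).subset fun i (hi : Nontrivial _) => ?_
      by_contra h
      simp only [Set.mem_union, Set.mem_ofPred_eq, not_or, not_nontrivial_iff_subsingleton] at h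
      obtain ⟨h1, h3⟩ := h
      exact not_nontrivial_iff_subsingleton.2
        (@subsingleton_of_exact R _ _ _ _ _ _ _ _ _ _ _ _ (ex i) h1 h3) hi

instance : (perfect R).IsClosedUnderIsomorphisms where
  of_iso := by
    rintro X Y e ⟨K, h, h', ⟨e'⟩⟩
    exact ⟨K, h, h', ⟨e.symm ≪≫ e'⟩⟩

instance : (perfect R).IsTriangulatedClosed₃ := .mk' (by
  rintro T hT ⟨K, ⟨a, b, hKa, hKb⟩, hK, ⟨e₁⟩⟩ ⟨L, ⟨c, d, hLc, hLd⟩, hL, ⟨e₂⟩⟩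
  have (i : ℤ) : Projective (K.X i) := (IsProjective.iff_projective _).1 (hK i).2
  have := CochainComplex.isKProjective_of_projective K b
  obtain ⟨g, hg⟩ := (CochainComplex.IsKProjective.Qh_map_bijective K
    ((HomotopyCategory.quotient _ _).obj L)).surjective
      ((DerivedCategory.quotientCompQhIso _).hom.app K ≫ e₁.inv ≫ T.mor₁ ≫ e₂.hom ≫
        (DerivedCategory.quotientCompQhIso _).inv.app L)
  obtain ⟨φ, rfl⟩ := (HomotopyCategory.quotient _ _).map_surjective g
  have hφ : e₁.inv ≫ T.mor₁ ≫ e₂.hom = DerivedCategory.Q.map φ := by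
    have := (DerivedCategory.quotientCompQhIso (ModuleCat.{u} R)).hom.naturality φ
    dsimp at this
    rw [hg] at this
    simpa using this
  refine ⟨CochainComplex.mappingCone φ, ⟨min (a - 1) c, max (b - 1) d, ?_, ?_⟩, fun i => ?_, ⟨?_⟩⟩
  · rw [CochainComplex.isStrictlyGE_iff]
    intro i hi
    rw [CochainComplex.mappingCone.isZero_X_iff]
    exact ⟨K.isZero_of_isStrictlyGE a _ (by grind), L.isZero_of_isStrictlyGE c _ (by grind)⟩
  · rw [CochainComplex.isStrictlyLE_iff]
    intro i hi
    rw [CochainComplex.mappingCone.isZero_X_iff]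
    exact ⟨K.isZero_of_isStrictlyLE b _ (by grind), L.isZero_of_isStrictlyLE d _ (by grind)⟩
  · have e := (HomologicalComplex.homotopyCofiber.XIsoBiprod φ i (i + 1) rfl ≪≫
      ModuleCat.biprodIsoProd _ _).toLinearEquiv
    have := (hK (i + 1)).1
    have := (hK (i + 1)).2
    have := (hL i).1
    have := (hL i).2
    exact ⟨Module.Finite.equiv e.symm, Module.Projective.of_equiv e.symm⟩
  · exact Triangle.π₃.mapIso (isoTriangleOfIso₁₂ T _ hT
      (DerivedCategory.mappingCone_triangle_distinguished φ) e₁ e₂ (by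
        change T.mor₁ ≫ e₂.hom = e₁.hom ≫ DerivedCategory.Q.map φ
        rw [← hφ, Iso.hom_inv_id_assoc])))

instance : (perfect R).IsStableUnderShift ℤ where
  isStableUnderShiftBy n := ⟨by
    rintro X ⟨K, ⟨a, b, _, _⟩, hK, ⟨e⟩⟩
    refine ⟨K⟦n⟧, ⟨a - n, b - n, K.isStrictlyGE_shift a n _ (by lia),
      K.isStrictlyLE_shift b n _ (by lia)⟩, fun i => hK (i + n),
      ⟨(shiftFunctor _ n).mapIso e ≪≫ (DerivedCategory.Q.commShiftIso n).symm.app K⟩⟩⟩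

instance : (perfect R).IsTriangulated where
  exists_zero := ⟨0, isZero_zero _, 0, ⟨0, 0, inferInstance, inferInstance⟩, fun i => by
    have : Subsingleton ((0 : CochainComplex (ModuleCat.{u} R) ℤ).X i) :=
      ModuleCat.subsingleton_of_isZero
        ((HomologicalComplex.eval _ _ i).map_isZero (isZero_zero _))
    exact ⟨inferInstance, inferInstance⟩,
    ⟨DerivedCategory.Q.mapZeroObject.symm⟩⟩
  toIsTriangulatedClosed₂ := .of_isTriangulatedClosed₃

/-- The triangulated category `D^f(R)`. -/
abbrev Df [IsNoetherianRing R] : Type (u+1) := (finiteCohomology R).FullSubcategory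

instance [IsNoetherianRing R] (n : ℤ) : (shiftFunctor (Df R) n).Linear R where
  map_smul {X Y} f r := by
    apply (finiteCohomology R).ι.map_injective
    rw [← cancel_mono (((finiteCohomology R).ι.commShiftIso n).hom.app Y),
      Functor.commShiftIso_hom_naturality]
    have h (Z W : Df R) (g : Z ⟶ W) : (finiteCohomology R).ι.map (r • g) =
      r • (finiteCohomology R).ι.map g := rfl
    rw [h, h, Linear.smul_comp, Functor.commShiftIso_hom_naturality, Functor.map_smul,
      Linear.comp_smul]

/-- The full subcategory `perf(R)` of the perfect complexes in `D^f(R)`. -/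
abbrev perf [IsNoetherianRing R] : ObjectProperty (Df R) :=
  (perfect R).inverseImage (finiteCohomology R).ι

/-- The singularity category `D_sg(R) = D^f(R) / perf(R)`. -/
abbrev Dsg [IsNoetherianRing R] : Type (u+1) := VerdierQuotient (perf R)

end Df

section Loc

variable {R : Type u} [CommRing R] (p : Ideal R) [p.IsPrime]

/-- The exact functor `M ↦ M_p` from `R`-modules to `R_p`-modules. -/
noncomputable abbrev moduleLocalization : ModuleCat.{u} R ⥤ ModuleCat.{u} (Localization.AtPrime p) :=
  ModuleCat.localizedModuleFunctor p.primeCompl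

lemma finite_moduleLocalization (M : ModuleCat.{u} R) [Module.Finite R M] :
    Module.Finite (Localization.AtPrime p) ((moduleLocalization p).obj M) := by
  have : Module.Finite (Localization p.primeCompl) (M.localizedModule p.primeCompl) :=
    Module.Finite.of_isLocalizedModule p.primeCompl (M.localizedModuleMkLinearMap p.primeCompl)
  exact this

lemma projective_moduleLocalization (M : ModuleCat.{u} R) [Module.Projective R M] :
    Module.Projective (Localization.AtPrime p) ((moduleLocalization p).obj M) := by
  have : Module.Projective (Localization p.primeCompl) (M.localizedModule p.primeCompl) :=
    Module.projective_of_isLocalizedModule p.primeCompl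
      (M.localizedModuleMkLinearMap p.primeCompl)
  exact this

variable [HasDerivedCategory.{w₁} (ModuleCat.{u} R)]
  [HasDerivedCategory.{w₂} (ModuleCat.{u} (Localization.AtPrime p))]

/-- The functor `X ↦ X_p` from `D(R)` to `D(R_p)`. -/
noncomputable abbrev derivedLocalization : DerivedCategory (ModuleCat.{u} R) ⥤
    DerivedCategory (ModuleCat.{u} (Localization.AtPrime p)) :=
  (moduleLocalization p).mapDerivedCategory

lemma nonempty_homology_iso (X : DerivedCategory (ModuleCat.{u} R)) (i : ℤ) :
    Nonempty ((DerivedCategory.homologyFunctor _ i).obj ((derivedLocalization p).obj X) ≅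
      (moduleLocalization p).obj ((DerivedCategory.homologyFunctor _ i).obj X)) := by
  let K := DerivedCategory.Q.objPreimage X
  let e : DerivedCategory.Q.obj K ≅ X := DerivedCategory.Q.objObjPreimageIso X
  exact ⟨(DerivedCategory.homologyFunctor _ i).mapIso ((derivedLocalization p).mapIso e.symm ≪≫
      (moduleLocalization p).mapDerivedCategoryFactors.app K) ≪≫
    (DerivedCategory.homologyFunctorFactors _ i).app _ ≪≫
    (K.sc i).mapHomologyIso (moduleLocalization p) ≪≫
    (moduleLocalization p).mapIso ((DerivedCategory.homologyFunctorFactors _ i).symm.app K ≪≫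
      (DerivedCategory.homologyFunctor _ i).mapIso e)⟩

lemma finiteCohomology_derivedLocalization (X : DerivedCategory (ModuleCat.{u} R))
    (hX : finiteCohomology R X) : finiteCohomology _ ((derivedLocalization p).obj X) := by
  rw [finiteCohomology_iff] at hX ⊢
  have e (i : ℤ) := (nonempty_homology_iso p X i).some.toLinearEquiv
  refine ⟨fun i => ?_, hX.2.subset fun i (hi : Nontrivial _) => ?_⟩
  · have := hX.1 i
    have := finite_moduleLocalization p ((DerivedCategory.homologyFunctor _ i).obj X)
    exact Module.Finite.equiv (e i).symm
  · by_contra h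
    rw [Set.mem_ofPred_eq, not_nontrivial_iff_subsingleton] at h
    have h1 := (moduleLocalization p).map_isZero
      (ModuleCat.isZero_of_subsingleton ((DerivedCategory.homologyFunctor _ i).obj X))
    have h2 := ModuleCat.subsingleton_of_isZero
      (h1.of_iso (nonempty_homology_iso p X i).some)
    exact not_nontrivial_iff_subsingleton.2 h2 hi

lemma perfect_derivedLocalization (X : DerivedCategory (ModuleCat.{u} R))
    (hX : perfect R X) : perfect _ ((derivedLocalization p).obj X) := by
  obtain ⟨K, ⟨a, b, _, _⟩, hK, ⟨e⟩⟩ := hX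
  refine ⟨((moduleLocalization p).mapHomologicalComplex _).obj K, ⟨a, b, ?_, ?_⟩, fun i => ?_,
    ⟨(derivedLocalization p).mapIso e ≪≫ (moduleLocalization p).mapDerivedCategoryFactors.app K⟩⟩
  · rw [CochainComplex.isStrictlyGE_iff]
    exact fun i hi => (moduleLocalization p).map_isZero (K.isZero_of_isStrictlyGE a i hi)
  · rw [CochainComplex.isStrictlyLE_iff]
    exact fun i hi => (moduleLocalization p).map_isZero (K.isZero_of_isStrictlyLE b i hi)
  · have := (hK i).1
    have := (hK i).2
    exact ⟨finite_moduleLocalization p (K.X i), projective_moduleLocalization p (K.X i)⟩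

variable [IsNoetherianRing R]

/-- The functor `X ↦ X_p` from `D^f(R)` to `D^f(R_p)`. -/
noncomputable abbrev dfLocalization : Df R ⥤ Df (Localization.AtPrime p) :=
  (finiteCohomology _).lift ((finiteCohomology R).ι ⋙ derivedLocalization p)
    fun X => finiteCohomology_derivedLocalization p X.obj X.property

lemma dfLocalization_inverts : (perf R).trW.IsInvertedBy
    (dfLocalization p ⋙ VerdierQuotient.quotientFunctor (perf (Localization.AtPrime p))) := by
  rintro X Y f ⟨Z, g, h, hT, hZ⟩
  exact Localization.inverts (VerdierQuotient.quotientFunctor (perf (Localization.AtPrime p)))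
    (perf (Localization.AtPrime p)).trW _
    (ObjectProperty.trW.mk _ ((dfLocalization p).map_distinguished _ hT) (perfect_derivedLocalization p _ hZ))

/-- The functor `X ↦ X_p` from `D_sg(R)` to `D_sg(R_p)`, induced by `X ↦ X_p` from `D^f(R)` to
`D^f(R_p)`, which sends perfect complexes to perfect complexes. -/
noncomputable def dsgLocalization : Dsg R ⥤ Dsg (Localization.AtPrime p) :=
  Localization.lift
    (dfLocalization p ⋙ VerdierQuotient.quotientFunctor (perf (Localization.AtPrime p)))
    (dfLocalization_inverts p) (VerdierQuotient.quotientFunctor (perf R))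

noncomputable instance : Localization.Lifting (VerdierQuotient.quotientFunctor (perf R))
    (perf R).trW (dfLocalization p ⋙ VerdierQuotient.quotientFunctor (perf (Localization.AtPrime p)))
    (dsgLocalization p) :=
  inferInstanceAs (Localization.Lifting (VerdierQuotient.quotientFunctor (perf R)) (perf R).trW
    (dfLocalization p ⋙ VerdierQuotient.quotientFunctor (perf (Localization.AtPrime p)))
    (Localization.lift _ (dfLocalization_inverts p) (VerdierQuotient.quotientFunctor (perf R))))

/-- The square formed by `X ↦ X_p` on `D^f` and on `D_sg` and the two quotient functors commutes. -/
noncomputable def dsgLocalizationIso :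
    VerdierQuotient.quotientFunctor (perf R) ⋙ dsgLocalization p ≅
      dfLocalization p ⋙ VerdierQuotient.quotientFunctor (perf (Localization.AtPrime p)) :=
  Localization.Lifting.iso (VerdierQuotient.quotientFunctor (perf R)) (perf R).trW _ _

noncomputable instance : (dsgLocalization p).CommShift ℤ :=
  Functor.commShiftOfLocalization (VerdierQuotient.quotientFunctor (perf R)) (perf R).trW ℤ
    (dfLocalization p ⋙ VerdierQuotient.quotientFunctor (perf (Localization.AtPrime p))) (dsgLocalization p)

instance : NatTrans.CommShift (dsgLocalizationIso p).hom ℤ :=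
  NatTrans.commShift_iso_hom_of_localization _ _ _ _ _

instance : (dsgLocalization p).IsTriangulated :=
  have := Localization.essSurj_mapArrow (VerdierQuotient.quotientFunctor (perf R)) (perf R).trW
  Functor.isTriangulated_of_precomp_iso (dsgLocalizationIso p)

end Loc

end SingularityCategory

/-!
Let `S = R ∖ p`. All three assertions follow from one property of `λ : D_sg(R) ⥤ D_sg(R_p)`: it is
essentially surjective, and `Hom(X, Y) → Hom(X_p, Y_p)` is a localization at `S`, that is, its
kernel is `S`-torsion (`FaithfulUpTo`) and each morphism `X_p ⟶ Y_p` becomes the image of a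
morphism `X ⟶ Y` after multiplication by an element of `S` (`FullUpTo`). Indeed, the
second half of this property is the claim on morphisms, and on `Hom(X, X)` it shows that `X_p = 0`
if and only if some `s ∈ S` kills `𝟙 X`, which describes the kernel of `λ`. Let `K` be the
subcategory of these torsion objects. The cone of multiplication by `s ∈ S` is killed by `s ^ 2`, so
`s` becomes invertible in `D_sg(R) / K`; denominators are then harmless, and the induced functor
`D_sg(R) / K ⥤ D_sg(R_p)` is an equivalence (`exists_equivalence_of_torsionQuotient`).

The property holds on `D^f` (`fullyFaithfulUpTo_derivedLocalization`). By dévissage along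
truncations (`prop_of_homology`) and the five lemma up to torsion
(`FaithfulUpTo.of_distinguished_left` and its three companions) it suffices to treat a shifted
finitely generated module `M[-i]` in the first variable. If `M` is projective, the second variable
may also be taken to be a shifted module, where the claim is that `Hom_R(M, N)` commutes with
localization. The general case follows by induction on `i` from a finite free presentation of `M`,
starting below the lower bound of the cohomology of `Y`, where all morphisms vanish.

Being full up to denominators also makes the essential image of an extension-closed subcategory
extension-closed (`isTriangulatedClosed₂_map`). As all finitely generated modules over `R_p`, and
all finitely generated projective (hence free) ones, come from modules of the same kind over `R`,
all of `D^f(R_p)` comes from `D^f(R)` and all of `perf(R_p)` from `perf(R)`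
(`finiteCohomology_le_map`, `perfect_le_map`).

Finally the property passes to the Verdier quotients by `perf` (`FaithfulUpTo.verdierQuotient`,
`FullUpTo.verdierQuotient`): a morphism killed in the quotient factors through a perfect complex
over `R_p`, and the denominator of a fraction is inverted because its cone is perfect; as
`perf(R_p)` comes from `perf(R)`, both factorizations and fractions lift to `R` up to elements
of `S`.
-/

namespace SingularityCategory

/-! ### Functors that are fully faithful up to denominators -/

section UpTo

variable {R : Type*} [CommRing R] (R' : Type*) [CommRing R'] [Algebra R R'] (S : Submonoid R)
  {C D : Type*} [Category C] [Category D] [Preadditive C] [Preadditive D]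
  [Linear R C] [Linear R' D]

variable (R) in
/-- A functor `F` from an `R`-linear category to an `R'`-linear category, where `R'` is an
`R`-algebra, is semilinear if `F (r • f) = r • F f` for all `r : R`. -/
def IsSemilinear (F : C ⥤ D) : Prop :=
  ∀ ⦃X Y : C⦄ (f : X ⟶ Y) (r : R), F.map (r • f) = algebraMap R R' r • F.map f

/-- The map `Hom(X, Y) → Hom(F X, F Y)` is injective up to `S`-torsion. -/
def FaithfulUpTo (F : C ⥤ D) (X Y : C) : Prop :=
  ∀ f : X ⟶ Y, F.map f = 0 → ∃ s ∈ S, s • f = 0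

/-- Every morphism `F X ⟶ F Y` is, up to a denominator in `S`, the image of a morphism `X ⟶ Y`. -/
def FullUpTo (F : C ⥤ D) (X Y : C) : Prop :=
  ∀ g : F.obj X ⟶ F.obj Y, ∃ s ∈ S, ∃ f : X ⟶ Y, F.map f = algebraMap R R' s • g

variable {R' S}

lemma FaithfulUpTo.of_iso {F : C ⥤ D} {X Y X' Y' : C} (e : X ≅ X') (e' : Y ≅ Y')
    (h : FaithfulUpTo S F X Y) : FaithfulUpTo S F X' Y' := by
  intro f hf
  obtain ⟨s, hs, h⟩ := h (e.hom ≫ f ≫ e'.inv) (by simp [F.map_comp, hf])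
  refine ⟨s, hs, ?_⟩
  rw [← Linear.comp_smul, ← Linear.smul_comp, Preadditive.IsIso.comp_left_eq_zero,
    Preadditive.IsIso.comp_right_eq_zero] at h
  exact h

omit [Preadditive C] [Linear R C] in
lemma FullUpTo.of_iso {F : C ⥤ D} {X Y X' Y' : C} (e : X ≅ X') (e' : Y ≅ Y')
    (h : FullUpTo R' S F X Y) : FullUpTo R' S F X' Y' := by
  intro g
  obtain ⟨s, hs, f, h⟩ := h (F.map e.hom ≫ g ≫ F.map e'.inv)
  refine ⟨s, hs, e.inv ≫ f ≫ e'.hom, ?_⟩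
  rw [F.map_comp, F.map_comp, h]
  simp [Linear.comp_smul, Linear.smul_comp, ← Functor.map_comp, ← Functor.map_comp_assoc]

lemma faithfulUpTo_of_subsingleton (F : C ⥤ D) {X Y : C} (h : ∀ f : X ⟶ Y, f = 0) :
    FaithfulUpTo S F X Y :=
  fun f _ => ⟨1, S.one_mem, by rw [h f, smul_zero]⟩

omit [Linear R C] in
lemma fullUpTo_of_subsingleton (F : C ⥤ D) [F.PreservesZeroMorphisms] {X Y : C}
    (h : ∀ g : F.obj X ⟶ F.obj Y, g = 0) : FullUpTo R' S F X Y :=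
  fun g => ⟨1, S.one_mem, 0, by rw [F.map_zero, h g, smul_zero]⟩

lemma algebraMap_smul_eq_zero_iff [IsLocalization S R'] {X Y : D} (f : X ⟶ Y) {s : R}
    (hs : s ∈ S) : algebraMap R R' s • f = 0 ↔ f = 0 :=
  (IsLocalization.map_units R' (⟨s, hs⟩ : S)).smul_eq_zero

section Square

variable {C₀ D₀ : Type*} [Category C₀] [Category D₀] [Preadditive C₀] [Preadditive D₀]
  [Linear R C₀] [Linear R' D₀] {Q : C₀ ⥤ C} {Q' : D₀ ⥤ D} {F : C₀ ⥤ D₀} {G : C ⥤ D}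
  (α : Q ⋙ G ≅ F ⋙ Q') [Q.Additive] [Q'.Additive]

omit [Q.Additive] [Q'.Additive] in
include α in
lemma IsSemilinear.of_square [Q.Linear R] [Q'.Linear R'] [Q.EssSurj]
    (hF : IsSemilinear R R' F) : IsSemilinear R R' G := by
  have key (X : C₀) (r : R) : G.map (r • 𝟙 (Q.obj X)) = algebraMap R R' r • 𝟙 _ := by
    have h := α.hom.naturality (r • 𝟙 X)
    dsimp at h
    rw [hF, Q.map_smul, Q'.map_smul, Linear.comp_smul, Q.map_id, F.map_id, Q'.map_id,
      Category.comp_id] at h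
    rw [← cancel_mono (α.hom.app X), h, Linear.smul_comp]
    exact congr_arg _ (Category.id_comp _).symm
  intro X Y f r
  have e := Q.objObjPreimageIso X
  have h : r • f = e.inv ≫ (r • 𝟙 _) ≫ e.hom ≫ f := by simp
  rw [h, G.map_comp, G.map_comp, key, Linear.smul_comp, Linear.comp_smul, Category.id_comp,
    ← G.map_comp, Iso.inv_hom_id_assoc]

include α in
lemma FaithfulUpTo.of_square [Q.Full] [Q.Linear R] [Q'.Faithful] {X Y : C₀}
    (h : FaithfulUpTo S F X Y) : FaithfulUpTo S G (Q.obj X) (Q.obj Y) := by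
  intro f hf
  obtain ⟨f, rfl⟩ := Q.map_surjective f
  obtain ⟨s, hs, h⟩ := h f (Q'.map_injective (by
    have := α.inv.naturality f
    dsimp at this
    rw [hf, comp_zero] at this
    rw [Q'.map_zero, ← cancel_mono (α.inv.app Y), this, zero_comp]))
  exact ⟨s, hs, by rw [← Q.map_smul, h, Q.map_zero]⟩

omit [Preadditive C] [Linear R C] [Preadditive C₀] [Linear R C₀] [Q.Additive] [Q'.Additive] in
include α in
lemma FullUpTo.of_square [Q'.Full] [Q'.Linear R'] {X Y : C₀}
    (h : FullUpTo R' S F X Y) : FullUpTo R' S G (Q.obj X) (Q.obj Y) := by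
  intro g
  obtain ⟨g', hg'⟩ := Q'.map_surjective (α.inv.app X ≫ g ≫ α.hom.app Y)
  obtain ⟨s, hs, f, h⟩ := h g'
  refine ⟨s, hs, Q.map f, ?_⟩
  have := α.hom.naturality f
  dsimp at this
  rw [h, Q'.map_smul, hg', Linear.comp_smul, ← cancel_mono (α.inv.app Y), Category.assoc,
    Linear.smul_comp] at this
  simpa using this

include α in
lemma FaithfulUpTo.of_square_of_faithful [Q.Faithful] [Q.Linear R] {X Y : C₀}
    (h : FaithfulUpTo S G (Q.obj X) (Q.obj Y)) : FaithfulUpTo S F X Y := by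
  intro f hf
  have := α.hom.naturality f
  dsimp at this
  rw [hf, Q'.map_zero, comp_zero] at this
  obtain ⟨s, hs, h⟩ := h (Q.map f) (by rw [← cancel_mono (α.hom.app Y), this, zero_comp])
  exact ⟨s, hs, Q.map_injective (by rw [Q.map_smul, h, Q.map_zero])⟩

omit [Preadditive C] [Linear R C] [Preadditive C₀] [Linear R C₀] [Q.Additive] [Q'.Additive] in
include α in
lemma FullUpTo.of_square_of_fullyFaithful [Q.Full] [Q'.Faithful] [Q'.Linear R'] {X Y : C₀}
    (h : FullUpTo R' S G (Q.obj X) (Q.obj Y)) : FullUpTo R' S F X Y := by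
  intro g
  obtain ⟨s, hs, f, h⟩ := h (α.hom.app X ≫ Q'.map g ≫ α.inv.app Y)
  obtain ⟨f, rfl⟩ := Q.map_surjective f
  refine ⟨s, hs, f, Q'.map_injective ?_⟩
  have := α.inv.naturality f
  dsimp at this
  rw [h, Linear.comp_smul, ← cancel_mono (α.hom.app Y), Category.assoc, Linear.smul_comp] at this
  simpa [Q'.map_smul] using this

end Square

section Triangulated

variable [HasZeroObject C] [HasShift C ℤ] [∀ n : ℤ, (shiftFunctor C n).Additive]
  [Pretriangulated C] [HasZeroObject D] [HasShift D ℤ]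
  [∀ n : ℤ, (shiftFunctor D n).Additive] [Pretriangulated D]
  {F : C ⥤ D} [F.CommShift ℤ] [F.IsTriangulated] {T : Triangle C}

/-- The inverse rotation of a distinguished triangle, up to the names of its last two morphisms. -/
lemma exists_distinguished_invRotate (hT : T ∈ distTriang C) :
    ∃ (δ : T.obj₃⟦(-1 : ℤ)⟧ ⟶ T.obj₁) (ε : T.obj₂ ⟶ T.obj₃⟦(-1 : ℤ)⟧⟦(1 : ℤ)⟧),
      Triangle.mk δ T.mor₁ ε ∈ distTriang C :=
  ⟨_, _, inv_rot_of_distTriang T hT⟩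

lemma exists_eq_map_mor₂_comp (hT : T ∈ distTriang C) {Y : D} (f : F.obj T.obj₂ ⟶ Y)
    (h : F.map T.mor₁ ≫ f = 0) : ∃ g : F.obj T.obj₃ ⟶ Y, f = F.map T.mor₂ ≫ g :=
  (F.mapTriangle.obj T).yoneda_exact₂ (F.map_distinguished T hT) f h

lemma exists_eq_map_mor₃_comp (hT : T ∈ distTriang C) {Y : D} (f : F.obj T.obj₃ ⟶ Y)
    (h : F.map T.mor₂ ≫ f = 0) : ∃ g : F.obj (T.obj₁⟦(1 : ℤ)⟧) ⟶ Y, f = F.map T.mor₃ ≫ g := by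
  obtain ⟨k, hk⟩ := (F.mapTriangle.obj T).yoneda_exact₃ (F.map_distinguished T hT) f h
  exact ⟨(F.commShiftIso (1 : ℤ)).hom.app T.obj₁ ≫ k, hk.trans (Category.assoc _ _ _)⟩

lemma exists_eq_comp_map_mor₁ (hT : T ∈ distTriang C) {X : D} (f : X ⟶ F.obj T.obj₂)
    (h : f ≫ F.map T.mor₂ = 0) : ∃ g : X ⟶ F.obj T.obj₁, f = g ≫ F.map T.mor₁ :=
  (F.mapTriangle.obj T).coyoneda_exact₂ (F.map_distinguished T hT) f h

variable (hF : IsSemilinear R R' F)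

include hF

/-- The half of the five lemma giving injectivity, up to `S`-torsion, for the long exact sequences of
`Hom(-, Y)` and `Hom(-, F Y)`. -/
lemma FaithfulUpTo.of_distinguished_left (hT : T ∈ distTriang C) {Y : C}
    (h₁ : FaithfulUpTo S F T.obj₁ Y) (h₃ : FaithfulUpTo S F T.obj₃ Y)
    (h : FullUpTo R' S F (T.obj₁⟦(1 : ℤ)⟧) Y) : FaithfulUpTo S F T.obj₂ Y := by
  intro f hf
  obtain ⟨s, hs, hs'⟩ := h₁ (T.mor₁ ≫ f) (by rw [F.map_comp, hf, comp_zero])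
  obtain ⟨g, hg⟩ := T.yoneda_exact₂ hT (s • f) (by rw [Linear.comp_smul, hs'])
  obtain ⟨k, hk⟩ := exists_eq_map_mor₃_comp hT (F.map g) (by
    rw [← F.map_comp, ← hg, hF, hf, smul_zero])
  obtain ⟨t, ht, l, hl⟩ := h k
  obtain ⟨t', ht', h'⟩ := h₃ (t • g - T.mor₃ ≫ l) (by
    rw [F.map_sub, hF, F.map_comp, hl, hk, Linear.comp_smul, sub_self])
  refine ⟨t' * t * s, S.mul_mem (S.mul_mem ht' ht) hs, ?_⟩
  have h'' := congr_arg (T.mor₂ ≫ ·) h'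
  simp only [Linear.comp_smul, Preadditive.comp_sub, comp_distTriang_mor_zero₂₃_assoc _ hT,
    zero_comp, sub_zero, comp_zero] at h''
  rw [mul_smul, mul_smul, hg, h'']

/-- The half of the five lemma giving surjectivity, up to denominators in `S`, for the long exact
sequences of `Hom(-, Y)` and `Hom(-, F Y)`. -/
lemma FullUpTo.of_distinguished_left (hT : T ∈ distTriang C) {Y : C}
    (h₁ : FullUpTo R' S F T.obj₁ Y) (h₃ : FullUpTo R' S F T.obj₃ Y)
    (h : FaithfulUpTo S F (T.obj₃⟦(-1 : ℤ)⟧) Y) : FullUpTo R' S F T.obj₂ Y := by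
  intro g
  obtain ⟨s, hs, f₁, hf₁⟩ := h₁ (F.map T.mor₁ ≫ g)
  obtain ⟨δ, ε, hT'⟩ := exists_distinguished_invRotate hT
  have hz : δ ≫ T.mor₁ = 0 := comp_distTriang_mor_zero₁₂ _ hT'
  obtain ⟨t, ht, hf⟩ := h (δ ≫ f₁) (by
    rw [F.map_comp, hf₁, Linear.comp_smul, ← Category.assoc, ← F.map_comp, hz, F.map_zero,
      zero_comp, smul_zero])
  obtain ⟨f₂, hf₂⟩ : ∃ f₂ : T.obj₂ ⟶ Y, t • f₁ = T.mor₁ ≫ f₂ :=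
    (Triangle.mk δ T.mor₁ ε).yoneda_exact₂ hT' (t • f₁) (by
      change δ ≫ (t • f₁) = 0
      rw [Linear.comp_smul, hf])
  obtain ⟨k, hk⟩ := exists_eq_map_mor₂_comp hT
    (algebraMap R R' (t * s) • g - F.map f₂) (by
      rw [Preadditive.comp_sub, ← F.map_comp, ← hf₂, hF, hf₁, Linear.comp_smul, map_mul, mul_smul,
        sub_self])
  obtain ⟨u, hu, f₃, hf₃⟩ := h₃ k
  refine ⟨u * (t * s), S.mul_mem hu (S.mul_mem ht hs), u • f₂ + T.mor₂ ≫ f₃, ?_⟩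
  rw [F.map_add, hF, F.map_comp, hf₃, Linear.comp_smul, ← hk, ← smul_add, add_sub_cancel,
    ← mul_smul, ← map_mul]

lemma FaithfulUpTo.of_distinguished_right (hT : T ∈ distTriang C) {X : C}
    (h₁ : FaithfulUpTo S F X T.obj₁) (h₃ : FaithfulUpTo S F X T.obj₃)
    (h : FullUpTo R' S F X (T.obj₃⟦(-1 : ℤ)⟧)) : FaithfulUpTo S F X T.obj₂ := by
  intro f hf
  obtain ⟨s, hs, hs'⟩ := h₃ (f ≫ T.mor₂) (by rw [F.map_comp, hf, zero_comp])
  obtain ⟨g, hg⟩ := T.coyoneda_exact₂ hT (s • f) (by rw [Linear.smul_comp, hs'])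
  obtain ⟨δ, ε, hT'⟩ := exists_distinguished_invRotate hT
  have hz : δ ≫ T.mor₁ = 0 := comp_distTriang_mor_zero₁₂ _ hT'
  obtain ⟨k, hk⟩ : ∃ k : F.obj X ⟶ F.obj (T.obj₃⟦(-1 : ℤ)⟧), F.map g = k ≫ F.map δ :=
    exists_eq_comp_map_mor₁ hT' (F.map g) (by
      change F.map g ≫ F.map T.mor₁ = 0
      rw [← F.map_comp, ← hg, hF, hf, smul_zero])
  obtain ⟨t, ht, l, hl⟩ := h k
  obtain ⟨t', ht', h'⟩ := h₁ (t • g - l ≫ δ) (by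
    rw [F.map_sub, hF, F.map_comp, hl, hk, Linear.smul_comp, sub_self])
  refine ⟨t' * t * s, S.mul_mem (S.mul_mem ht' ht) hs, ?_⟩
  have h'' := congr_arg (· ≫ T.mor₁) h'
  simp only [Linear.smul_comp, Preadditive.sub_comp, Category.assoc, hz,
    zero_comp, sub_zero, comp_zero] at h''
  rw [mul_smul, mul_smul, hg, h'']

lemma FullUpTo.of_distinguished_right (hT : T ∈ distTriang C) {X : C}
    (h₁ : FullUpTo R' S F X T.obj₁) (h₃ : FullUpTo R' S F X T.obj₃)
    (h : FaithfulUpTo S F X (T.obj₁⟦(1 : ℤ)⟧)) : FullUpTo R' S F X T.obj₂ := by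
  intro g
  obtain ⟨s, hs, f₁, hf₁⟩ := h₃ (g ≫ F.map T.mor₂)
  obtain ⟨t, ht, hf⟩ := h (f₁ ≫ T.mor₃) (by
    rw [F.map_comp, hf₁, Linear.smul_comp, Category.assoc, ← F.map_comp,
      comp_distTriang_mor_zero₂₃ _ hT, F.map_zero, comp_zero, smul_zero])
  obtain ⟨f₂, hf₂⟩ := T.coyoneda_exact₃ hT (t • f₁) (by rw [Linear.smul_comp, hf])
  obtain ⟨k, hk⟩ := exists_eq_comp_map_mor₁ hT
    (algebraMap R R' (t * s) • g - F.map f₂) (by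
      rw [Preadditive.sub_comp, ← F.map_comp, ← hf₂, hF, hf₁, Linear.smul_comp, map_mul, mul_smul,
        sub_self])
  obtain ⟨u, hu, f₃, hf₃⟩ := h₁ k
  refine ⟨u * (t * s), S.mul_mem hu (S.mul_mem ht hs), u • f₂ + f₃ ≫ T.mor₁, ?_⟩
  rw [F.map_add, hF, F.map_comp, hf₃, Linear.smul_comp, ← hk, ← smul_add, add_sub_cancel,
    ← mul_smul, ← map_mul]

end Triangulated

end UpTo

/-! ### Verdier quotients -/

section SMulIso

variable {R : Type*} [CommRing R] {R' : Type*} [CommRing R'] [Algebra R R'] {S : Submonoid R}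
  [IsLocalization S R'] {D : Type*} [Category D] [Preadditive D] [Linear R' D]

lemma isIso_algebraMap_smul_id (X : D) {s : R} (hs : s ∈ S) :
    IsIso (algebraMap R R' s • 𝟙 X) := by
  obtain ⟨u, hu⟩ := IsLocalization.map_units R' (⟨s, hs⟩ : S)
  have hu : algebraMap R R' s = u := hu.symm
  refine ⟨(↑u⁻¹ : R') • 𝟙 X, ?_, ?_⟩ <;> simp [hu, smul_smul]

/-- The composite of `e` with multiplication by the invertible scalar `s`. -/
noncomputable def smulIso {X Y : D} (e : X ≅ Y) {s : R}
    (hs : s ∈ S) : X ≅ Y :=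
  have := isIso_algebraMap_smul_id (R' := R') X hs
  asIso (algebraMap R R' s • 𝟙 X) ≪≫ e

lemma smulIso_hom {X Y : D} (e : X ≅ Y) {s : R}
    (hs : s ∈ S) : (smulIso (R' := R') e hs).hom = algebraMap R R' s • e.hom := by
  simp [smulIso]

end SMulIso

section Verdier

universe v' u'

variable {R : Type*} [CommRing R] {R' : Type*} [CommRing R'] [Algebra R R'] {S : Submonoid R}
  {C : Type u} [Category.{v} C] [HasZeroObject C] [HasShift C ℤ] [Preadditive C]
  [∀ n : ℤ, (shiftFunctor C n).Additive] [Pretriangulated C]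
  {D : Type u'} [Category.{v'} D] [HasZeroObject D] [HasShift D ℤ] [Preadditive D]
  [∀ n : ℤ, (shiftFunctor D n).Additive] [Pretriangulated D]

section EssImage

variable [Linear R C] [Linear R' D] (F : C ⥤ D) [F.CommShift ℤ] [F.IsTriangulated]
  [IsLocalization S R']

omit [Linear R C] in
/-- If morphisms between images of objects in `P` come from `C` up to denominators, then
the images of the objects in `P` are closed under extensions: a connecting morphism may be
multiplied by a denominator without changing the middle term up to isomorphism. -/
lemma isTriangulatedClosed₂_map (P : ObjectProperty C) [P.IsTriangulatedClosed₂]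
    (h : ∀ A B, P A → P B → FullUpTo R' S F B (A⟦(1 : ℤ)⟧)) :
    (P.map F).IsTriangulatedClosed₂ := .mk' (by
  rintro T hT ⟨A, hA, ⟨eA⟩⟩ ⟨B, hB, ⟨eB⟩⟩
  obtain ⟨s, hs, f, hf⟩ := h A B hA hB
    (eB.hom ≫ T.mor₃ ≫ eA.inv⟦(1 : ℤ)⟧' ≫ (F.commShiftIso (1 : ℤ)).inv.app A)
  obtain ⟨E, hE, a, b, hT'⟩ := P.distinguished_cocone_triangle₂ f hA hB
  have hFT := F.map_distinguished _ hT'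
  -- `s • T.mor₃` corresponds to `F f`, and `s` is invertible, so both triangles have isomorphic
  -- connecting morphisms.
  obtain ⟨e, -, -⟩ := exists_iso_of_arrow_iso _ _ (rot_of_distTriang _ (rot_of_distTriang _ hFT))
    (rot_of_distTriang _ (rot_of_distTriang _ hT))
    (Arrow.isoMk (smulIso (R' := R') eB hs) ((shiftFunctor D (1 : ℤ)).mapIso eA) (by
      change (smulIso eB hs).hom ≫ T.mor₃ =
        (F.map f ≫ (F.commShiftIso (1 : ℤ)).hom.app A) ≫ eA.hom⟦(1 : ℤ)⟧'
      rw [smulIso_hom, hf]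
      simp [← Functor.map_comp, Linear.smul_comp]))
  exact ⟨E, hE, ⟨(shiftFunctor D (1 : ℤ)).preimageIso (Triangle.π₃.mapIso e)⟩⟩)

end EssImage

section Quotient

variable [IsTriangulated C] [IsTriangulated D] (P : ObjectProperty C) [P.IsTriangulated]
  (P' : ObjectProperty D) [P'.IsTriangulated]

lemma isZero_quotientFunctor_obj {X : C} (hX : P X) :
    IsZero ((VerdierQuotient.quotientFunctor P).obj X) := by
  have h : P.trW (0 : X ⟶ 0) :=
    ObjectProperty.trW.mk' P (contractible_distinguished X) hX
  have := Localization.inverts (VerdierQuotient.quotientFunctor P) P.trW _ h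
  exact ((VerdierQuotient.quotientFunctor P).map_isZero (isZero_zero C)).of_iso
    (asIso ((VerdierQuotient.quotientFunctor P).map (0 : X ⟶ 0)))

instance : (VerdierQuotient.quotientFunctor P).EssSurj :=
  Localization.essSurj (VerdierQuotient.quotientFunctor P) P.trW

variable {P P'}
variable [Linear R C] [Linear R' D] {F : C ⥤ D} [F.CommShift ℤ] [F.IsTriangulated]
  {G : VerdierQuotient P ⥤ VerdierQuotient P'}
  (α : VerdierQuotient.quotientFunctor P ⋙ G ≅ F ⋙ VerdierQuotient.quotientFunctor P')
  (hF : IsSemilinear R R' F) (hfaithful : ∀ X Y, FaithfulUpTo S F X Y)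
  (hfull : ∀ X Y, FullUpTo R' S F X Y) (hP' : P' ≤ P.map F)

include α hF hfaithful hfull hP' in
/-- A morphism killed by `C / P ⥤ D / P'` becomes, in `D`, a morphism factoring through an
object of `P'`; up to denominators the factorization comes from `C`. -/
theorem FaithfulUpTo.verdierQuotient (X Y : VerdierQuotient P) : FaithfulUpTo S G X Y := by
  let L := VerdierQuotient.quotientFunctor P
  let L' := VerdierQuotient.quotientFunctor P'
  suffices ∀ X Y : C, FaithfulUpTo S G (L.obj X) (L.obj Y) from
    (this _ _).of_iso (L.objObjPreimageIso X) (L.objObjPreimageIso Y)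
  intro X Y f hf
  obtain ⟨φ, rfl⟩ := Localization.exists_leftFraction L P.trW f
  have hs := Localization.inverts L P.trW _ φ.hs
  have h₁ : G.map (L.map φ.f) = 0 := by
    rw [← φ.map_comp_map_s L (Localization.inverts L P.trW), G.map_comp, hf, zero_comp]
  have h₂ : L'.map (F.map φ.f) = L'.map 0 := by
    have := α.inv.naturality φ.f
    dsimp at this
    rw [h₁, comp_zero] at this
    rw [L'.map_zero, ← cancel_mono (α.inv.app φ.Y'), zero_comp]
    exact this
  rw [MorphismProperty.map_eq_iff_postcomp L' P'.trW] at h₂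
  obtain ⟨Z, t, ht, h₂⟩ := h₂
  rw [zero_comp] at h₂
  rw [ObjectProperty.trW_iff'] at ht
  obtain ⟨W, a, b, hT, hW⟩ := ht
  obtain ⟨k, hk⟩ : ∃ k : F.obj X ⟶ W, F.map φ.f = k ≫ a :=
    (Triangle.mk a t b).coyoneda_exact₂ hT (F.map φ.f) h₂
  obtain ⟨A, hA, ⟨e⟩⟩ := hP' _ hW
  obtain ⟨s₁, hs₁, k', hk'⟩ := hfull X A (k ≫ e.inv)
  obtain ⟨s₂, hs₂, a', ha'⟩ := hfull A φ.Y' (e.hom ≫ a)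
  -- Up to torsion, `(s₁ * s₂) • φ.f` factors through `A`, which is zero in `C / P`.
  obtain ⟨s₃, hs₃, h₃⟩ := hfaithful _ _ (k' ≫ a' - (s₁ * s₂) • φ.f) (by
    rw [F.map_sub, hF, F.map_comp, hk', ha', hk, Linear.smul_comp, Linear.comp_smul, smul_smul,
      map_mul]
    simp)
  refine ⟨s₃ * (s₁ * s₂), S.mul_mem hs₃ (S.mul_mem hs₁ hs₂), ?_⟩
  have h₄ : (s₃ * (s₁ * s₂)) • L.map φ.f = 0 := by
    have h₅ := congr_arg L.map h₃
    rw [smul_sub, L.map_sub, L.map_smul, L.map_comp,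
      (isZero_quotientFunctor_obj P hA).eq_of_tgt (L.map k') 0, zero_comp, smul_zero, L.map_zero,
      zero_sub, neg_eq_zero, smul_smul, L.map_smul] at h₅
    exact h₅
  rw [← φ.map_comp_map_s L (Localization.inverts L P.trW), ← Linear.smul_comp,
    Preadditive.IsIso.comp_right_eq_zero] at h₄
  exact h₄

omit [IsTriangulated C] [Linear R C] in
include α hfull hP' in
/-- In a left fraction representing a morphism of `D / P'`, first the denominator, whose cocone
lies in `P'`, and then the numerator are replaced by images of morphisms of `C`. -/
theorem FullUpTo.verdierQuotient [IsLocalization S R'] (X Y : VerdierQuotient P) :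
    FullUpTo R' S G X Y := by
  let L := VerdierQuotient.quotientFunctor P
  let L' := VerdierQuotient.quotientFunctor P'
  suffices ∀ X Y : C, FullUpTo R' S G (L.obj X) (L.obj Y) from
    (this _ _).of_iso (L.objObjPreimageIso X) (L.objObjPreimageIso Y)
  intro X Y g
  obtain ⟨φ, hφ⟩ := Localization.exists_leftFraction L' P'.trW (α.inv.app X ≫ g ≫ α.hom.app Y)
  obtain ⟨W, a, b, hT, hW⟩ := (ObjectProperty.trW_iff' _ _).1 φ.hs
  obtain ⟨A, hA, ⟨e⟩⟩ := hP' _ hW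
  obtain ⟨s₁, hs₁, a', ha'⟩ := hfull A Y (e.hom ≫ a)
  obtain ⟨Z, t, c, hT'⟩ := distinguished_cocone_triangle a'
  -- `F a'` differs from `a` by an invertible scalar, so `F t` and `φ.s` agree up to an
  -- isomorphism of their targets.
  obtain ⟨e', -, he'⟩ := exists_iso_of_arrow_iso _ _ (F.map_distinguished _ hT') hT
    (Arrow.isoMk (smulIso (R' := R') e hs₁) (Iso.refl _) (by
      change (smulIso e hs₁).hom ≫ a = F.map a' ≫ 𝟙 _
      rw [smulIso_hom, ha', Category.comp_id, Linear.smul_comp]))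
  obtain ⟨w, hw⟩ : ∃ w : F.obj Z ≅ φ.Y', F.map t ≫ w.hom = φ.s := by
    refine ⟨Triangle.π₃.mapIso e', e'.hom.comm₂.trans ?_⟩
    rw [he']
    exact Category.id_comp _
  obtain ⟨s₂, hs₂, f, hf⟩ := hfull X Z (φ.f ≫ w.inv)
  have ht : P.trW t := ObjectProperty.trW.mk' P hT' hA
  have := Localization.inverts L P.trW t ht
  refine ⟨s₂, hs₂, L.map f ≫ inv (L.map t), ?_⟩
  have hφ' : (α.inv.app X ≫ g ≫ α.hom.app Y) ≫ L'.map (F.map t) =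
      L'.map (φ.f ≫ w.inv) := by
    rw [hφ, ← cancel_mono (L'.map w.hom), Category.assoc, ← L'.map_comp, ← L'.map_comp, hw,
      φ.map_comp_map_s, Category.assoc, w.inv_hom_id, Category.comp_id]
  have h₁ := α.hom.naturality f
  have h₂ := α.hom.naturality t
  dsimp at h₁ h₂
  rw [← cancel_mono (G.map (L.map t)), ← cancel_mono (α.hom.app Z), ← cancel_epi (α.inv.app X),
    ← G.map_comp]
  change _ = α.inv.app X ≫ (_ ≫ G.map ((VerdierQuotient.quotientFunctor P).map t)) ≫ _
  rw [Category.assoc _ _ (α.hom.app Z), h₂, Category.assoc, IsIso.inv_hom_id, Category.comp_id]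
  change _ ≫ G.map ((VerdierQuotient.quotientFunctor P).map f) ≫ _ = _
  rw [h₁, hf, Functor.map_smul, Linear.comp_smul, Linear.comp_smul, Iso.inv_hom_id_app_assoc]
  change _ • L'.map _ = _
  rw [← hφ', Linear.smul_comp, Linear.comp_smul]
  simp only [Category.assoc]
  rfl

end Quotient

end Verdier

/-! ### The Verdier quotient by the torsion objects -/

section TorsionQuotient

universe v' u'

variable {R : Type*} [CommRing R] {R' : Type*} [CommRing R'] [Algebra R R'] {S : Submonoid R}
  {C : Type u} [Category.{v} C] [HasZeroObject C] [HasShift C ℤ] [Preadditive C]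
  [∀ n : ℤ, (shiftFunctor C n).Additive] [Pretriangulated C] [IsTriangulated C]
  [Linear R C] [∀ n : ℤ, (shiftFunctor C n).Linear R]
  {D : Type u'} [Category.{v'} D] [HasZeroObject D] [HasShift D ℤ] [Preadditive D]
  [∀ n : ℤ, (shiftFunctor D n).Additive] [Pretriangulated D] [Linear R' D]

omit [IsTriangulated C] in
/-- The cone of multiplication by `s` is killed by `s ^ 2`. -/
lemma mul_self_smul_id_eq_zero {T : Triangle C} (hT : T ∈ distTriang C) {s : R}
    (e : T.obj₁ = T.obj₂) (h : T.mor₁ = s • eqToHom e) : (s * s) • 𝟙 T.obj₃ = 0 := by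
  have h₁₂ : s • T.mor₂ = 0 := by
    have := comp_distTriang_mor_zero₁₂ T hT
    rw [h, Linear.smul_comp, ← Linear.comp_smul, Preadditive.IsIso.comp_left_eq_zero] at this
    exact this
  have h₃₁ : s • T.mor₃ = 0 := by
    have := comp_distTriang_mor_zero₃₁ T hT
    rw [h, Functor.map_smul, Linear.comp_smul, ← Linear.smul_comp,
      Preadditive.IsIso.comp_right_eq_zero] at this
    exact this
  obtain ⟨g, hg⟩ := T.yoneda_exact₃ hT (s • 𝟙 T.obj₃) (by
    rw [Linear.comp_smul, Category.comp_id, h₁₂])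
  rw [mul_smul, hg, ← Linear.smul_comp, h₃₁, zero_comp]

omit [IsTriangulated C] in
variable (S) in
lemma isIso_quotientFunctor_map_smul_id (K : ObjectProperty C) [K.IsTriangulated]
    (hK : ∀ X, K X ↔ ∃ s ∈ S, s • 𝟙 X = 0) (X : C) {s : R} (hs : s ∈ S) :
    IsIso ((VerdierQuotient.quotientFunctor K).map (s • 𝟙 X)) := by
  obtain ⟨Z, a, b, hT⟩ := distinguished_cocone_triangle (s • 𝟙 X)
  exact Localization.inverts (VerdierQuotient.quotientFunctor K) K.trW _
    ⟨Z, a, b, hT, (hK Z).2 ⟨s * s, S.mul_mem hs hs, mul_self_smul_id_eq_zero hT rfl rfl⟩⟩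

variable (G : C ⥤ D) [G.CommShift ℤ] [G.IsTriangulated] [IsLocalization S R']

omit [IsTriangulated C] [∀ (n : ℤ), Functor.Linear R (shiftFunctor C n)] in
lemma isZero_obj_iff_of_faithfulUpTo (hG : IsSemilinear R R' G)
    (hfaithful : ∀ X Y, FaithfulUpTo S G X Y) (X : C) :
    IsZero (G.obj X) ↔ ∃ s ∈ S, s • 𝟙 X = 0 := by
  constructor
  · intro h
    exact hfaithful X X (𝟙 X) (h.eq_of_src _ _)
  · rintro ⟨s, hs, h⟩
    rw [IsZero.iff_id_eq_zero, ← algebraMap_smul_eq_zero_iff (R' := R') (𝟙 (G.obj X)) hs,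
      ← G.map_id, ← hG, h, G.map_zero]

/-- If `G` is full and faithful up to denominators in `S` and essentially surjective, then it
exhibits its target as the Verdier quotient of its source by the `S`-torsion objects. -/
theorem exists_equivalence_of_torsionQuotient (hG : IsSemilinear R R' G)
    (hfaithful : ∀ X Y, FaithfulUpTo S G X Y) (hfull : ∀ X Y, FullUpTo R' S G X Y)
    (hsurj : G.EssSurj) (K : ObjectProperty C) [K.IsTriangulated]
    (hK : ∀ X, K X ↔ ∃ s ∈ S, s • 𝟙 X = 0) :
    ∃ (F : VerdierQuotient K ⥤ D) (_ : F.CommShift ℤ)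
      (e : VerdierQuotient.quotientFunctor K ⋙ F ≅ G),
      F.IsTriangulated ∧ F.IsEquivalence ∧ NatTrans.CommShift e.hom ℤ := by
  let L := VerdierQuotient.quotientFunctor K
  have hinv : K.trW.IsInvertedBy G := by
    rintro X Y f ⟨Z, g, h, hT, hZ⟩
    refine ((G.mapTriangle.obj (Triangle.mk f g h)).isZero₃_iff_isIso₁
      (G.map_distinguished _ hT)).1 ?_
    exact (isZero_obj_iff_of_faithfulUpTo G hG hfaithful Z).2 ((hK Z).1 hZ)
  obtain ⟨F, ⟨_⟩⟩ : ∃ F : VerdierQuotient K ⥤ D, Nonempty (Localization.Lifting L K.trW G F) :=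
    ⟨Localization.lift G hinv L, ⟨inferInstance⟩⟩
  let e : L ⋙ F ≅ G := Localization.Lifting.iso L K.trW G F
  let : F.CommShift ℤ := Functor.commShiftOfLocalization L K.trW ℤ G F
  have he : NatTrans.CommShift e.hom ℤ := NatTrans.commShift_iso_hom_of_localization _ _ _ _ _
  have hF : F.IsTriangulated :=
    have := Localization.essSurj_mapArrow L K.trW
    Functor.isTriangulated_of_precomp_iso e
  refine ⟨F, inferInstance, e, hF, ?_, he⟩
  have hiso (X : C) {s : R} (hs : s ∈ S) : IsIso (L.map (s • 𝟙 X)) :=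
    isIso_quotientFunctor_map_smul_id S K hK X hs
  have hne {X Y : C} (f : X ⟶ Y) : F.map (L.map f) = e.hom.app X ≫ G.map f ≫ e.inv.app Y := by
    have := e.hom.naturality f
    dsimp at this
    rw [← Category.assoc, ← this, Category.assoc, Iso.hom_inv_id_app]
    exact (Category.comp_id _).symm
  have : F.Faithful := by
    refine Functor.faithful_of_comp_cancel_zero_of_hasLeftCalculusOfFractions L K.trW F ?_
    intro X Y f hf
    have hGf : G.map f = 0 := by
      have := e.hom.naturality f
      dsimp at this
      rw [hf, zero_comp] at this
      exact (Preadditive.IsIso.comp_left_eq_zero _ _).1 this.symm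
    obtain ⟨s, hs, h⟩ := hfaithful X Y f hGf
    have := hiso X hs
    rw [← Preadditive.IsIso.comp_left_eq_zero (L.map (s • 𝟙 X)), ← L.map_comp, Linear.smul_comp,
      Category.id_comp, h, L.map_zero]
  have : F.Full := by
    refine Functor.full_of_comp_essSurj F L fun X Y g => ?_
    obtain ⟨s, hs, f, hf⟩ := hfull X Y (e.inv.app X ≫ g ≫ e.hom.app Y)
    have := hiso X hs
    refine ⟨inv (L.map (s • 𝟙 X)) ≫ L.map f, ?_⟩
    have h₁ := e.hom.naturality f
    have h₂ := e.hom.naturality (s • 𝟙 X)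
    dsimp at h₁ h₂
    rw [hG, G.map_id, Linear.comp_smul, Category.comp_id] at h₂
    rw [F.map_comp, F.map_inv, IsIso.inv_comp_eq, ← cancel_mono (e.hom.app Y), h₁, hf,
      Category.assoc, ← cancel_epi (e.inv.app X)]
    have h₃ : e.inv.app X ≫ F.map (L.map (s • 𝟙 X)) = algebraMap R R' s • e.inv.app X := by
      rw [← cancel_mono (e.hom.app X), Category.assoc, h₂, Linear.comp_smul, Linear.smul_comp]
    rw [reassoc_of% h₃, Linear.comp_smul, Linear.comp_smul, Iso.inv_hom_id_app_assoc,
      Linear.smul_comp]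
  have : F.EssSurj := ⟨fun Y => ⟨L.obj (G.objPreimage Y),
    ⟨e.app _ ≪≫ G.objObjPreimageIso Y⟩⟩⟩
  exact { }

end TorsionQuotient

/-! ### Dévissage in derived categories -/

section Devissage

variable {A : Type u} [Category.{v} A] [Abelian A] [HasDerivedCategory.{w} A]
  (P : ObjectProperty (DerivedCategory A)) [P.IsClosedUnderIsomorphisms] [P.IsTriangulatedClosed₂]
  (N : ObjectProperty A) [N.IsClosedUnderIsomorphisms]
  (h : ∀ (n : ℤ) (M : A), N M → P ((DerivedCategory.singleFunctor A n).obj M))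

open DerivedCategory

include h

/-- A bounded object of the derived category is an iterated extension of its shifted cohomology
objects, which are split off by the canonical truncations. -/
theorem prop_of_homology (a : ℤ) (k : ℕ) (X : DerivedCategory A) (hGE : X.IsGE a)
    (hLE : X.IsLE (a + k)) (hX : ∀ i, N ((homologyFunctor A i).obj X)) : P X := by
  have hsingle (Y : DerivedCategory A) (n : ℤ) (hY : N ((homologyFunctor A n).obj Y))
      (_ : Y.IsGE n) (_ : Y.IsLE n) : P Y := by
    obtain ⟨M, ⟨e⟩⟩ := exists_iso_singleFunctor_obj_of_isGE_of_isLE Y n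
    exact P.prop_of_iso e.symm (h n M (N.prop_of_iso ((homologyFunctor A n).mapIso e ≪≫
      (singleFunctorCompHomologyFunctorIso A n).app M) hY))
  induction k generalizing X with
  | zero => exact hsingle X a (hX a) hGE (by simpa using hLE)
  | succ k hk =>
    have hzero (Z : A) (hZ : IsZero Z) : N Z :=
      N.prop_of_iso ((X.isZero_of_isGE a (a - 1) (by lia)).iso hZ) (hX (a - 1))
    obtain ⟨Y, Z, hY, hZ, f, g, δ, hT⟩ := TStructure.t.exists_triangle X (a + k) (a + k + 1) rfl
    have hY : Y.IsLE (a + k) := ⟨hY⟩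
    have hZ : Z.IsGE (a + k + 1) := ⟨hZ⟩
    have hf (i : ℤ) (hi : i ≤ a + k) : IsIso ((homologyFunctor A i).map f) := by
      have : Mono ((homologyFunctor A i).map f) :=
        (HomologySequence.mono_homologyMap_mor₁_iff _ hT (i - 1) i).2
          ((Z.isZero_of_isGE (a + k + 1) (i - 1) (by lia)).eq_of_src _ _)
      have : Epi ((homologyFunctor A i).map f) :=
        (HomologySequence.epi_homologyMap_mor₁_iff _ hT i).2
          ((Z.isZero_of_isGE (a + k + 1) i (by lia)).eq_of_tgt _ _)
      exact isIso_of_mono_of_epi _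
    have hg (i : ℤ) (hi : a + k + 1 ≤ i) : IsIso ((homologyFunctor A i).map g) := by
      have : Mono ((homologyFunctor A i).map g) :=
        (HomologySequence.mono_homologyMap_mor₂_iff _ hT i).2
          ((Y.isZero_of_isLE (a + k) i (by lia)).eq_of_src _ _)
      have : Epi ((homologyFunctor A i).map g) :=
        (HomologySequence.epi_homologyMap_mor₂_iff _ hT i (i + 1)).2
          ((Y.isZero_of_isLE (a + k) (i + 1) (by lia)).eq_of_tgt _ _)
      exact isIso_of_mono_of_epi _
    refine P.ext_of_isTriangulatedClosed₂ _ hT (hk Y ?_ hY fun i => ?_)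
      (hsingle Z (a + k + 1) ?_ hZ ?_)
    · rw [isGE_iff]
      intro i hi
      have := hf i (by lia)
      exact (X.isZero_of_isGE a i hi).of_iso (asIso ((homologyFunctor A i).map f))
    · by_cases hi : i ≤ a + k
      · have := hf i hi
        exact N.prop_of_iso (asIso ((homologyFunctor A i).map f)).symm (hX i)
      · exact hzero _ (Y.isZero_of_isLE (a + k) i (by lia))
    · have := hg _ le_rfl
      exact N.prop_of_iso (asIso ((homologyFunctor A (a + k + 1)).map g)) (hX _)
    · rw [isLE_iff]
      intro i hi
      have := hg i (by lia)
      exact (X.isZero_of_isLE (a + (k + 1 : ℕ)) i (by push_cast; lia)).of_iso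
        (asIso ((homologyFunctor A i).map g)).symm

/-- A bounded complex is an iterated extension of its shifted terms: the term in the highest degree
is a subcomplex. -/
theorem prop_of_terms (a : ℤ) (k : ℕ) (K : CochainComplex A ℤ) (hGE : K.IsStrictlyGE a)
    (hLE : K.IsStrictlyLE (a + k)) (hK : ∀ i, N (K.X i)) : P (Q.obj K) := by
  induction k generalizing K with
  | zero =>
    have : K.IsStrictlyLE a := by simpa using hLE
    obtain ⟨M, ⟨e⟩⟩ := CochainComplex.exists_iso_single K a
    refine P.prop_of_iso (Q.mapIso e.symm) (h a M (N.prop_of_iso ?_ (hK a)))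
    exact (HomologicalComplex.eval _ (ComplexShape.up ℤ) a).mapIso e ≪≫
      HomologicalComplex.singleObjXSelf (ComplexShape.up ℤ) a M
  | succ k hk =>
    have hzero (Z : A) (hZ : IsZero Z) : N Z :=
      N.prop_of_iso ((K.isZero_of_isStrictlyGE a (a - 1) (by lia)).iso hZ) (hK (a - 1))
    obtain ⟨b, hb⟩ : ∃ b : ℤ, b = a + (k + 1 : ℕ) := ⟨_, rfl⟩
    rw [← hb] at hLE
    let ι : (HomologicalComplex.single A (ComplexShape.up ℤ) b).obj (K.X b) ⟶ K :=
      HomologicalComplex.mkHomFromSingle (𝟙 _) (by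
        rintro _ rfl
        exact (K.isZero_of_isStrictlyLE b _ (by lia)).eq_of_tgt _ _)
    have hιb : IsIso (ι.f b) := by
      dsimp only [ι]
      rw [HomologicalComplex.mkHomFromSingle_f, Category.comp_id]
      infer_instance
    have hιi (i : ℤ) (hi : i ≠ b) :
        IsZero (((HomologicalComplex.single A (ComplexShape.up ℤ) b).obj (K.X b)).X i) :=
      HomologicalComplex.isZero_single_obj_X _ _ _ _ hi
    have : Mono ι := by
      have (i : ℤ) : Mono (ι.f i) := by
        by_cases hi : i = b
        · subst hi
          infer_instance
        · exact ⟨fun _ _ _ => (hιi i hi).eq_of_tgt _ _⟩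
      exact HomologicalComplex.mono_of_mono_f _ this
    have hS : (ShortComplex.mk ι (cokernel.π ι) (cokernel.condition ι)).ShortExact :=
      { exact := ShortComplex.exact_cokernel ι }
    have hb₃ : IsZero ((cokernel ι).X b) :=
      (hS.map_of_exact (HomologicalComplex.eval A _ b)).isIso_f_iff.1 hιb
    have hi₃ (i : ℤ) (hi : i ≠ b) : IsIso ((cokernel.π ι).f i) :=
      (hS.map_of_exact (HomologicalComplex.eval A _ i)).isIso_g_iff.2 (hιi i hi)
    refine P.ext_of_isTriangulatedClosed₂ _ (triangleOfSES_distinguished hS) (h b _ (hK b))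
      (hk (cokernel ι) ?_ ?_ fun i => ?_)
    · rw [CochainComplex.isStrictlyGE_iff]
      intro i hi
      have := hi₃ i (by lia)
      exact (K.isZero_of_isStrictlyGE a i hi).of_iso (asIso ((cokernel.π ι).f i)).symm
    · rw [CochainComplex.isStrictlyLE_iff]
      intro i hi
      by_cases hi' : i = b
      · exact hi' ▸ hb₃
      · have := hi₃ i hi'
        exact (K.isZero_of_isStrictlyLE b i (by lia)).of_iso (asIso ((cokernel.π ι).f i)).symm
    · by_cases hi : i = b
      · exact hzero _ (hi ▸ hb₃)
      · have := hi₃ i hi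
        exact N.prop_of_iso (asIso ((cokernel.π ι).f i)) (hK i)

end Devissage

/-! ### Finitely generated modules over a localization -/

section Modules

variable {R : Type u} [CommRing R] (p : Ideal R) [p.IsPrime]

instance (M : ModuleCat.{u} R) :
    IsLocalizedModule p.primeCompl (M.localizedModuleMkLinearMap p.primeCompl) :=
  ModuleCat.localizedModule_isLocalizedModule M p.primeCompl

lemma nonempty_moduleLocalization_iso (N : ModuleCat.{u} R) {M : Type u} [AddCommGroup M]
    [Module R M] [Module (Localization.AtPrime p) M]
    [IsScalarTower R (Localization.AtPrime p) M] (f : N →ₗ[R] M)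
    [IsLocalizedModule p.primeCompl f] :
    Nonempty ((moduleLocalization p).obj N ≅ ModuleCat.of (Localization.AtPrime p) M) := by
  let e := IsLocalizedModule.linearEquiv p.primeCompl
    (N.localizedModuleMkLinearMap p.primeCompl) f
  let l : (moduleLocalization p).obj N ⟶ ModuleCat.of (Localization.AtPrime p) M :=
    ModuleCat.ofHom
      (e.toLinearMap.extendScalarsOfIsLocalization p.primeCompl (Localization p.primeCompl))
  have : IsIso l := (ConcreteCategory.isIso_iff_bijective l).2 e.bijective
  exact ⟨asIso l⟩

/-- A module over `R_p` is the localization of the `R`-submodule spanned by any generating set. -/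
lemma isLocalizedModule_subtype_span {M : Type u} [AddCommGroup M] [Module R M]
    [Module (Localization.AtPrime p) M] [IsScalarTower R (Localization.AtPrime p) M] (s : Set M)
    (hs : Submodule.span (Localization.AtPrime p) s = ⊤) :
    IsLocalizedModule p.primeCompl (Submodule.span R s).subtype where
  map_units x := (isLocalizedModule_id p.primeCompl M (Localization.AtPrime p)).map_units x
  surj m := by
    obtain ⟨t, ht⟩ := multiple_mem_span_of_mem_localization_span p.primeCompl
      (Localization.AtPrime p) s m (hs ▸ Submodule.mem_top)
    exact ⟨(⟨_, ht⟩, t), rfl⟩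
  exists_of_eq {x y} hxy := ⟨1, by rw [Subtype.ext hxy]⟩

lemma exists_finite_moduleLocalization_iso (M : ModuleCat.{u} (Localization.AtPrime p))
    [Module.Finite (Localization.AtPrime p) M] :
    ∃ N : ModuleCat.{u} R, Module.Finite R N ∧ Nonempty ((moduleLocalization p).obj N ≅ M) := by
  let : Module R M := Module.compHom M (algebraMap R (Localization.AtPrime p))
  have : IsScalarTower R (Localization.AtPrime p) M :=
    ⟨fun r s m => by rw [Algebra.smul_def, mul_smul]; rfl⟩
  obtain ⟨s, hs⟩ := (Module.Finite.fg_top : (⊤ : Submodule (Localization.AtPrime p) M).FG)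
  have := isLocalizedModule_subtype_span p (s : Set M) hs
  exact ⟨ModuleCat.of R (Submodule.span R (s : Set M)),
    Module.Finite.span_of_finite R s.finite_toSet,
    nonempty_moduleLocalization_iso p (ModuleCat.of R (Submodule.span R (s : Set M)))
      (Submodule.span R (s : Set M)).subtype⟩

/-- Finitely generated projective modules over the local ring `R_p` are free. -/
lemma exists_finite_projective_moduleLocalization_iso
    (M : ModuleCat.{u} (Localization.AtPrime p))
    [Module.Finite (Localization.AtPrime p) M] [Module.Projective (Localization.AtPrime p) M] :
    ∃ N : ModuleCat.{u} R, Module.Finite R N ∧ Module.Projective R N ∧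
      Nonempty ((moduleLocalization p).obj N ≅ M) := by
  have : Module.Free (Localization.AtPrime p) M := Module.free_of_flat_of_isLocalRing
  let e := (Module.finBasis (Localization.AtPrime p) M).equivFun
  let ι := Fin (Module.finrank (Localization.AtPrime p) M)
  obtain ⟨e'⟩ := nonempty_moduleLocalization_iso p (ModuleCat.of R (ι → R))
    (M := ι → Localization.AtPrime p)
    (.pi fun i => Algebra.linearMap R (Localization.AtPrime p) ∘ₗ .proj i)
  exact ⟨ModuleCat.of R (ι → R), inferInstanceAs (Module.Finite R (ι → R)),
    inferInstanceAs (Module.Projective R (ι → R)), ⟨e' ≪≫ e.symm.toModuleIso⟩⟩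

end Modules

/-! ### Extension-closed classes of objects -/

section FullyFaithfulUpTo

variable {R : Type*} [CommRing R] (R' : Type*) [CommRing R'] [Algebra R R'] (S : Submonoid R)
  {C D : Type*} [Category C] [Category D] [Preadditive C] [Preadditive D]
  [Linear R C] [Linear R' D]

/-- Up to `S`-torsion and denominators in `S`, the map `Hom(X, Y) → Hom(F X, F Y)` is bijective.
If `F` is semilinear, this means that it is a localization at `S`. -/
def FullyFaithfulUpTo (F : C ⥤ D) (X Y : C) : Prop :=
  FaithfulUpTo S F X Y ∧ FullUpTo R' S F X Y

variable {R' S}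

lemma FullyFaithfulUpTo.of_iso {F : C ⥤ D} {X Y X' Y' : C} (h : FullyFaithfulUpTo R' S F X Y)
    (e : X ≅ X') (e' : Y ≅ Y') : FullyFaithfulUpTo R' S F X' Y' :=
  ⟨h.1.of_iso e e', h.2.of_iso e e'⟩

variable [HasZeroObject C] [HasShift C ℤ] [∀ n : ℤ, (shiftFunctor C n).Additive]
  [Pretriangulated C] [HasZeroObject D] [HasShift D ℤ]
  [∀ n : ℤ, (shiftFunctor D n).Additive] [Pretriangulated D]
  {F : C ⥤ D} [F.CommShift ℤ] [F.IsTriangulated]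
  (hF : IsSemilinear R R' F)

variable (R' S F) in
/-- The objects `Y` such that `F` is fully faithful up to `S` on `Hom(X, Y⟦n⟧)` for all `n`. -/
def fullyFaithfulRight (X : C) : ObjectProperty C := fun Y =>
  ∀ n : ℤ, FullyFaithfulUpTo R' S F X (Y⟦n⟧)

variable (R' S F) in
/-- The objects `X` such that `F` is fully faithful up to `S` on `Hom(X⟦n⟧, Y)` for all `n`. -/
def fullyFaithfulLeft (Y : C) : ObjectProperty C := fun X =>
  ∀ n : ℤ, FullyFaithfulUpTo R' S F (X⟦n⟧) Y

instance (X : C) : (fullyFaithfulRight R' S F X).IsClosedUnderIsomorphisms where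
  of_iso e h n := (h n).of_iso (Iso.refl _) ((shiftFunctor C n).mapIso e)

instance (Y : C) : (fullyFaithfulLeft R' S F Y).IsClosedUnderIsomorphisms where
  of_iso e h n := (h n).of_iso ((shiftFunctor C n).mapIso e) (Iso.refl _)

include hF

lemma isTriangulatedClosed₂_fullyFaithfulRight (X : C) :
    (fullyFaithfulRight R' S F X).IsTriangulatedClosed₂ := .mk' (by
  intro T hT h₁ h₃ n
  have hT' := Triangle.shift_distinguished T hT n
  exact ⟨.of_distinguished_right hF hT' (h₁ n).1 (h₃ n).1 ((h₃ (n + -1)).2.of_iso (Iso.refl _)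
      ((shiftFunctorAdd' C n (-1) (n + -1) rfl).app T.obj₃)),
    .of_distinguished_right hF hT' (h₁ n).2 (h₃ n).2 ((h₁ (n + 1)).1.of_iso (Iso.refl _)
      ((shiftFunctorAdd' C n 1 (n + 1) rfl).app T.obj₁))⟩)

lemma isTriangulatedClosed₂_fullyFaithfulLeft (Y : C) :
    (fullyFaithfulLeft R' S F Y).IsTriangulatedClosed₂ := .mk' (by
  intro T hT h₁ h₃ n
  have hT' := Triangle.shift_distinguished T hT n
  exact ⟨.of_distinguished_left hF hT' (h₁ n).1 (h₃ n).1 ((h₁ (n + 1)).2.of_iso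
      ((shiftFunctorAdd' C n 1 (n + 1) rfl).app T.obj₁) (Iso.refl _)),
    .of_distinguished_left hF hT' (h₁ n).2 (h₃ n).2 ((h₃ (n + -1)).1.of_iso
      ((shiftFunctorAdd' C n (-1) (n + -1) rfl).app T.obj₃) (Iso.refl _))⟩)

end FullyFaithfulUpTo

/-! ### Complexes with finitely generated cohomology and perfect complexes -/

section ModuleObjects

variable (R : Type u) [CommRing R]

/-- The finitely generated modules. -/
def finiteModules : ObjectProperty (ModuleCat.{u} R) := fun M => Module.Finite R M

/-- The finitely generated projective modules. -/
def finiteProjectiveModules : ObjectProperty (ModuleCat.{u} R) :=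
  fun M => Module.Finite R M ∧ Module.Projective R M

instance : (finiteModules R).IsClosedUnderIsomorphisms where
  of_iso e h := by
    have : Module.Finite R _ := h
    exact Module.Finite.equiv e.toLinearEquiv

instance : (finiteProjectiveModules R).IsClosedUnderIsomorphisms where
  of_iso e := by
    rintro ⟨_, _⟩
    exact ⟨Module.Finite.equiv e.toLinearEquiv, Module.Projective.of_equiv e.toLinearEquiv⟩

variable [HasDerivedCategory.{w} (ModuleCat.{u} R)]

open DerivedCategory

lemma exists_bounds_of_finiteCohomology {X : DerivedCategory (ModuleCat.{u} R)}
    (hX : finiteCohomology R X) : ∃ (a : ℤ) (k : ℕ), X.IsGE a ∧ X.IsLE (a + k) := by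
  rw [finiteCohomology_iff] at hX
  obtain ⟨a, ha⟩ := hX.2.bddBelow
  obtain ⟨b, hb⟩ := hX.2.bddAbove
  have hzero (i : ℤ) (hi : i < a ∨ b < i) :
      IsZero ((homologyFunctor (ModuleCat.{u} R) i).obj X) := by
    by_contra h
    have hi' : i ∈ {i : ℤ | Nontrivial ((homologyFunctor (ModuleCat.{u} R) i).obj X)} := by
      by_contra h'
      rw [Set.mem_ofPred_eq, not_nontrivial_iff_subsingleton] at h'
      exact h (ModuleCat.isZero_of_subsingleton _)
    have := ha hi'
    have := hb hi'
    lia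
  refine ⟨a, (b - a).toNat, ?_, ?_⟩
  · rw [isGE_iff]
    exact fun i hi => hzero i (Or.inl hi)
  · rw [isLE_iff]
    exact fun i hi => hzero i (Or.inr (by lia))

lemma finiteCohomology_singleFunctor {M : ModuleCat.{u} R} [Module.Finite R M] (n : ℤ) :
    finiteCohomology R ((singleFunctor _ n).obj M) := by
  have h (i : ℤ) (hi : i ≠ n) :
      Subsingleton ((homologyFunctor (ModuleCat.{u} R) i).obj
        ((singleFunctor (ModuleCat.{u} R) n).obj M)) := by
    apply ModuleCat.subsingleton_of_isZero
    rcases lt_or_gt_of_ne hi with hi | hi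
    · exact isZero_of_isGE _ n i hi
    · exact isZero_of_isLE _ n i hi
  rw [finiteCohomology_iff]
  refine ⟨fun i => ?_, (Set.finite_singleton n).subset fun i (hi : Nontrivial _) => ?_⟩
  · by_cases hi : i = n
    · subst hi
      exact (finiteModules R).prop_of_iso
        ((singleFunctorCompHomologyFunctorIso (ModuleCat.{u} R) i).app M).symm
        (inferInstanceAs (Module.Finite R M))
    · have := h i hi
      infer_instance
  · by_contra hi'
    exact not_nontrivial_iff_subsingleton.2 (h i hi') hi

lemma perfect_singleFunctor {M : ModuleCat.{u} R} (hM : finiteProjectiveModules R M) (n : ℤ) :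
    perfect R ((singleFunctor _ n).obj M) := by
  refine ⟨(CochainComplex.singleFunctor _ n).obj M, ⟨n, n, inferInstance, inferInstance⟩,
    fun i => ?_, ⟨(singleFunctorIsoCompQ _ n).app M⟩⟩
  by_cases hi : i = n
  · subst hi
    exact (finiteProjectiveModules R).prop_of_iso
      (HomologicalComplex.singleObjXSelf (ComplexShape.up ℤ) i M).symm hM
  · have := ModuleCat.subsingleton_of_isZero
      (HomologicalComplex.isZero_single_obj_X (ComplexShape.up ℤ) n M i hi)
    exact ⟨inferInstanceAs (Module.Finite R
        (((HomologicalComplex.single _ (ComplexShape.up ℤ) n).obj M).X i)),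
      inferInstanceAs (Module.Projective R
        (((HomologicalComplex.single _ (ComplexShape.up ℤ) n).obj M).X i))⟩

/-- An extension-closed class of objects which contains the shifts of the finitely generated
modules contains all complexes with finitely generated total cohomology. -/
theorem finiteCohomology_le (P : ObjectProperty (DerivedCategory (ModuleCat.{u} R)))
    [P.IsClosedUnderIsomorphisms] [P.IsTriangulatedClosed₂]
    (h : ∀ (n : ℤ) (M : ModuleCat.{u} R), Module.Finite R M → P ((singleFunctor _ n).obj M)) :
    finiteCohomology R ≤ P := by
  intro X hX
  obtain ⟨a, k, ha, hk⟩ := exists_bounds_of_finiteCohomology R hX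
  exact prop_of_homology P (finiteModules R) h a k X ha hk ((finiteCohomology_iff R X).1 hX).1

/-- An extension-closed class of objects which contains the shifts of the finitely generated
projective modules contains all perfect complexes. -/
theorem perfect_le (P : ObjectProperty (DerivedCategory (ModuleCat.{u} R)))
    [P.IsClosedUnderIsomorphisms] [P.IsTriangulatedClosed₂]
    (h : ∀ (n : ℤ) (M : ModuleCat.{u} R), Module.Finite R M → Module.Projective R M →
      P ((singleFunctor _ n).obj M)) :
    perfect R ≤ P := by
  rintro X ⟨K, ⟨a, b, ha, hb⟩, hK, ⟨e⟩⟩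
  exact P.prop_of_iso e.symm (prop_of_terms P (finiteProjectiveModules R)
    (fun n M hM => h n M hM.1 hM.2) a (b - a).toNat K ha (K.isStrictlyLE_of_le b _ (by lia)) hK)

end ModuleObjects

/-! ### Localization of modules and derived categories -/

section ModuleHoms

variable {R : Type u} [CommRing R] (p : Ideal R) [p.IsPrime]

lemma isSemilinear_moduleLocalization :
    IsSemilinear R (Localization.AtPrime p) (moduleLocalization p) := by
  intro M N f r
  apply ModuleCat.hom_ext
  refine LinearMap.ext fun (x : M.localizedModule p.primeCompl) => ?_
  change IsLocalizedModule.map p.primeCompl (M.localizedModuleMkLinearMap p.primeCompl)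
      (N.localizedModuleMkLinearMap p.primeCompl) (r • f.hom) x =
    algebraMap R (Localization p.primeCompl) r •
      IsLocalizedModule.map p.primeCompl (M.localizedModuleMkLinearMap p.primeCompl)
        (N.localizedModuleMkLinearMap p.primeCompl) f.hom x
  rw [map_smul, LinearMap.smul_apply, algebraMap_smul]

lemma fullyFaithfulUpTo_moduleLocalization (M N : ModuleCat.{u} R)
    [Module.FinitePresentation R M] :
    FullyFaithfulUpTo (Localization.AtPrime p) p.primeCompl (moduleLocalization p) M N := by
  have h := Module.FinitePresentation.isLocalizedModule_mapExtendScalars p.primeCompl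
    (M.localizedModuleMkLinearMap p.primeCompl) (N.localizedModuleMkLinearMap p.primeCompl)
    (Localization p.primeCompl)
  constructor
  · intro f hf
    obtain ⟨s, hs⟩ := h.exists_of_eq (x₁ := f.hom) (x₂ := 0) (by
      rw [map_zero]
      exact congr_arg ModuleCat.Hom.hom hf)
    refine ⟨s, s.2, ModuleCat.hom_ext (hs.trans (smul_zero _))⟩
  · intro g
    obtain ⟨⟨f, s⟩, hs⟩ := h.surj (g.hom : M.localizedModule p.primeCompl →ₗ[
      Localization p.primeCompl] N.localizedModule p.primeCompl)
    refine ⟨s, s.2, ModuleCat.ofHom f, ModuleCat.hom_ext (hs.symm.trans ?_)⟩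
    refine LinearMap.ext fun (x : M.localizedModule p.primeCompl) => ?_
    exact (algebraMap_smul (Localization p.primeCompl) (s : R)
      (show N.localizedModule p.primeCompl from g.hom x)).symm

end ModuleHoms

section Derived

open DerivedCategory

lemma singleFunctor_hom_eq_zero {R : Type u} [CommRing R]
    [HasDerivedCategory.{w} (ModuleCat.{u} R)] (M N : ModuleCat.{u} R) [Module.Projective R M]
    {i j : ℤ} (hij : i ≠ j) (f : (singleFunctor _ i).obj M ⟶ (singleFunctor _ j).obj N) :
    f = 0 := by
  rcases lt_or_gt_of_ne hij with hij | hij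
  · exact TStructure.t.zero f i j hij
  · have : Projective M := (IsProjective.iff_projective _).1 inferInstance
    exact from_singleFunctor_obj_eq_zero_of_projective
      (L := (CochainComplex.singleFunctor _ j).obj N) f j hij

variable {R : Type u} [CommRing R] (p : Ideal R) [p.IsPrime]
  [HasDerivedCategory.{w₁} (ModuleCat.{u} R)]
  [HasDerivedCategory.{w₂} (ModuleCat.{u} (Localization.AtPrime p))]

lemma isSemilinear_derivedLocalization :
    IsSemilinear R (Localization.AtPrime p) (derivedLocalization p) := by
  have : (Q : CochainComplex (ModuleCat.{u} R) ℤ ⥤ _).EssSurj :=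
    Localization.essSurj _ (HomologicalComplex.quasiIso _ _)
  refine IsSemilinear.of_square (moduleLocalization p).mapDerivedCategoryFactors
    (F := (moduleLocalization p).mapHomologicalComplex (ComplexShape.up ℤ)) fun K L f r => ?_
  ext i : 1
  exact isSemilinear_moduleLocalization p (f.f i) r

/-- On shifts of modules, the first of which is projective, all morphisms between distinct degrees
vanish before and after localization. -/
lemma fullyFaithfulUpTo_singleFunctor_of_projective (M N : ModuleCat.{u} R)
    [Module.FinitePresentation R M] [Module.Projective R M] (i j : ℤ) :
    FullyFaithfulUpTo (Localization.AtPrime p) p.primeCompl (derivedLocalization p)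
      ((singleFunctor _ i).obj M) ((singleFunctor _ j).obj N) := by
  obtain rfl | hij := eq_or_ne i j
  · have h := fullyFaithfulUpTo_moduleLocalization p M N
    let α := (moduleLocalization p).mapDerivedCategorySingleFunctor i
    exact ⟨h.1.of_square α, h.2.of_square α⟩
  · have := projective_moduleLocalization p M
    refine ⟨faithfulUpTo_of_subsingleton _
      (singleFunctor_hom_eq_zero M N hij), fullUpTo_of_subsingleton _ fun g => ?_⟩
    have := singleFunctor_hom_eq_zero ((moduleLocalization p).obj M)
      ((moduleLocalization p).obj N) hij
      (((moduleLocalization p).mapDerivedCategorySingleFunctor i).inv.app M ≫ g ≫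
        ((moduleLocalization p).mapDerivedCategorySingleFunctor j).hom.app N)
    rwa [Preadditive.IsIso.comp_left_eq_zero, Preadditive.IsIso.comp_right_eq_zero] at this

variable [IsNoetherianRing R]

lemma fullyFaithfulUpTo_of_projective (M : ModuleCat.{u} R) [Module.Finite R M]
    [Module.Projective R M] (i : ℤ) {Y : DerivedCategory (ModuleCat.{u} R)}
    (hY : finiteCohomology R Y) :
    FullyFaithfulUpTo (Localization.AtPrime p) p.primeCompl (derivedLocalization p)
      ((singleFunctor _ i).obj M) Y := by
  have : Module.FinitePresentation R M := Module.finitePresentation_of_finite R M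
  have := isTriangulatedClosed₂_fullyFaithfulRight (S := p.primeCompl)
    (isSemilinear_derivedLocalization p) ((singleFunctor _ i).obj M)
  have hle := finiteCohomology_le R (fullyFaithfulRight (Localization.AtPrime p) p.primeCompl
    (derivedLocalization p) ((singleFunctor _ i).obj M)) fun j N _ n =>
      (fullyFaithfulUpTo_singleFunctor_of_projective p M N i (j - n)).of_iso (Iso.refl _)
        (((singleFunctors _).shiftIso n (j - n) j (by lia)).app N).symm
  exact (hle Y hY 0).of_iso (Iso.refl _) ((shiftFunctorZero _ ℤ).app Y)

/-- The case of a shifted module. Since `Y` is bounded below, `Hom(M[-i], Y)` and its analogue over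
`R_p` vanish for small `i`. The inductive step uses a presentation `0 ⟶ M' ⟶ F ⟶ M ⟶ 0` with
`F` finite free, and the triangle `F[-i] ⟶ M[-i] ⟶ M'[-i+1] ⟶ F[-i+1]`. -/
lemma fullyFaithfulUpTo_singleFunctor (M : ModuleCat.{u} R) [Module.Finite R M]
    (i : ℤ) {Y : DerivedCategory (ModuleCat.{u} R)} (hY : finiteCohomology R Y) :
    FullyFaithfulUpTo (Localization.AtPrime p) p.primeCompl (derivedLocalization p)
      ((singleFunctor _ i).obj M) Y := by
  obtain ⟨a, -, ha, -⟩ := exists_bounds_of_finiteCohomology R hY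
  have hF := isSemilinear_derivedLocalization p
  have shiftIso (N : ModuleCat.{u} R) (i : ℤ) :
      (singleFunctor _ (i - 1)).obj N ≅ ((singleFunctor _ i).obj N)⟦(1 : ℤ)⟧ :=
    (((singleFunctors _).shiftIso 1 (i - 1) i (by lia)).app N).symm
  suffices ∀ (k : ℕ) (i : ℤ) (_ : i < a + k) (M : ModuleCat.{u} R) (_ : Module.Finite R M),
      FullyFaithfulUpTo (Localization.AtPrime p) p.primeCompl (derivedLocalization p)
        ((singleFunctor _ i).obj M) Y from
    this (i - a + 1).toNat i (by lia) M inferInstance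
  intro k
  induction k with
  | zero =>
    intro i hi M _
    have hY' : ((derivedLocalization p).obj Y).IsGE a := by
      rw [isGE_iff]
      intro j hj
      exact ((moduleLocalization p).map_isZero (Y.isZero_of_isGE a j hj)).of_iso
        (nonempty_homology_iso p Y j).some
    refine ⟨faithfulUpTo_of_subsingleton _ fun f => TStructure.t.zero f i a (by simpa using hi),
      fullUpTo_of_subsingleton _ fun g => ?_⟩
    have : (((moduleLocalization p).mapDerivedCategorySingleFunctor i).inv.app M ≫ g) = 0 :=
      TStructure.t.zero (X := (singleFunctor _ i).obj ((moduleLocalization p).obj M)) _ i a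
        (by simpa using hi)
    rwa [Preadditive.IsIso.comp_left_eq_zero] at this
  | succ k hk =>
    intro i hi
    have resolution (M : ModuleCat.{u} R) (_ : Module.Finite R M) :
        ∃ M' F : ModuleCat.{u} R, Module.Finite R M' ∧ Module.Finite R F ∧ Module.Projective R F ∧
          ∃ f g h, Triangle.mk (f : (singleFunctor _ i).obj F ⟶ (singleFunctor _ i).obj M)
            (g : _ ⟶ ((singleFunctor _ i).obj M')⟦(1 : ℤ)⟧) h ∈ distTriang _ := by
      obtain ⟨n, f, hf⟩ := Module.Finite.exists_fin' R M
      let S : ShortComplex (ModuleCat.{u} R) := ShortComplex.mk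
        (ModuleCat.ofHom (LinearMap.ker f).subtype) (ModuleCat.ofHom f) (by ext x; exact x.2)
      have hS : S.ShortExact :=
        { exact := (ShortComplex.ShortExact.moduleCat_exact_iff_function_exact _).2
            (LinearMap.exact_subtype_ker_map f)
          mono_f := (ModuleCat.mono_iff_injective _).2 Subtype.val_injective
          epi_g := (ModuleCat.epi_iff_surjective _).2 hf }
      refine ⟨_, S.X₂, inferInstanceAs (Module.Finite R (LinearMap.ker f)),
        inferInstanceAs (Module.Finite R (Fin n → R)),
        inferInstanceAs (Module.Projective R (Fin n → R)), _, _, _, rot_of_distTriang _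
          (triangleOfSES_distinguished
            (hS.map_of_exact (HomologicalComplex.single _ (ComplexShape.up ℤ) i)))⟩
    -- Faithfulness for all modules comes first, as fullness for `M` uses it for `M'`.
    have hfaithful (M : ModuleCat.{u} R) (hM : Module.Finite R M) :
        FaithfulUpTo p.primeCompl (derivedLocalization p) ((singleFunctor _ i).obj M) Y := by
      obtain ⟨M', F, _, _, _, f, g, h, hT⟩ := resolution M hM
      exact .of_distinguished_left hF hT (fullyFaithfulUpTo_of_projective p F i hY).1
        ((hk (i - 1) (by lia) M' inferInstance).1.of_iso (shiftIso M' i) (Iso.refl _))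
        ((fullyFaithfulUpTo_of_projective p F (i - 1) hY).2.of_iso (shiftIso F i) (Iso.refl _))
    refine fun M hM => ⟨hfaithful M hM, ?_⟩
    obtain ⟨M', F, _, _, _, f, g, h, hT⟩ := resolution M hM
    exact .of_distinguished_left hF hT (fullyFaithfulUpTo_of_projective p F i hY).2
      ((hk (i - 1) (by lia) M' inferInstance).2.of_iso (shiftIso M' i) (Iso.refl _))
      ((hfaithful M' inferInstance).of_iso ((shiftEquiv _ (1 : ℤ)).unitIso.app _) (Iso.refl _))

/-- `Hom(X, Y)_p ≅ Hom(X_p, Y_p)` for complexes `X` and `Y` with finitely generated total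
cohomology. -/
theorem fullyFaithfulUpTo_derivedLocalization {X Y : DerivedCategory (ModuleCat.{u} R)}
    (hX : finiteCohomology R X) (hY : finiteCohomology R Y) :
    FullyFaithfulUpTo (Localization.AtPrime p) p.primeCompl (derivedLocalization p) X Y := by
  have := isTriangulatedClosed₂_fullyFaithfulLeft (S := p.primeCompl)
    (isSemilinear_derivedLocalization p) Y
  have hle := finiteCohomology_le R (fullyFaithfulLeft (Localization.AtPrime p) p.primeCompl
    (derivedLocalization p) Y) fun j N _ n =>
      (fullyFaithfulUpTo_singleFunctor p N (j - n) hY).of_iso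
        (((singleFunctors _).shiftIso n (j - n) j (by lia)).app N).symm (Iso.refl _)
  exact (hle X hX 0).of_iso ((shiftFunctorZero _ ℤ).app X) (Iso.refl _)

instance : (finiteCohomology R).IsClosedUnderIsomorphisms where
  of_iso e h := by
    rw [finiteCohomology_iff] at h ⊢
    have e' (i : ℤ) := ((homologyFunctor (ModuleCat.{u} R) i).mapIso e).toLinearEquiv
    refine ⟨fun i => ?_, h.2.subset fun i (hi : Nontrivial _) => (e' i).toEquiv.nontrivial⟩
    have := h.1 i
    exact Module.Finite.equiv (e' i)

lemma isTriangulatedClosed₂_map_derivedLocalization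
    (P : ObjectProperty (DerivedCategory (ModuleCat.{u} R))) [P.IsTriangulatedClosed₂]
    (hP : P ≤ finiteCohomology R) : (P.map (derivedLocalization p)).IsTriangulatedClosed₂ :=
  isTriangulatedClosed₂_map (R := R) (R' := Localization.AtPrime p) (S := p.primeCompl) _ P
    fun _ _ hA hB => (fullyFaithfulUpTo_derivedLocalization p (hP _ hB)
      ((finiteCohomology R).le_shift _ _ (hP _ hA))).2

theorem finiteCohomology_le_map :
    finiteCohomology (Localization.AtPrime p) ≤
      (finiteCohomology R).map (derivedLocalization p) := by
  have := isTriangulatedClosed₂_map_derivedLocalization p (finiteCohomology R) le_rfl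
  refine finiteCohomology_le _ _ fun n M _ => ?_
  obtain ⟨N, _, ⟨e⟩⟩ := exists_finite_moduleLocalization_iso p M
  exact ⟨(singleFunctor _ n).obj N, finiteCohomology_singleFunctor R n,
    ⟨((moduleLocalization p).mapDerivedCategorySingleFunctor n).app N ≪≫
      (singleFunctor _ n).mapIso e⟩⟩

theorem perfect_le_map :
    perfect (Localization.AtPrime p) ≤
      (perfect R ⊓ finiteCohomology R).map (derivedLocalization p) := by
  have := isTriangulatedClosed₂_map_derivedLocalization p (perfect R ⊓ finiteCohomology R)
    inf_le_right
  refine perfect_le _ _ fun n M _ _ => ?_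
  obtain ⟨N, _, _, ⟨e⟩⟩ := exists_finite_projective_moduleLocalization_iso p M
  exact ⟨(singleFunctor _ n).obj N,
    ⟨perfect_singleFunctor R ⟨inferInstance, inferInstance⟩ n, finiteCohomology_singleFunctor R n⟩,
    ⟨((moduleLocalization p).mapDerivedCategorySingleFunctor n).app N ≪≫
      (singleFunctor _ n).mapIso e⟩⟩

end Derived

/-! ### Morphisms as localized modules -/

section LocalizedHom

variable {R : Type*} [CommRing R] {S : Submonoid R}
  {C D : Type*} [Category C] [Category D] [Preadditive C] [Preadditive D]
  [Linear R C] [Linear (Localization S) D]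

lemma exists_localizedModule_hom_equiv {F : C ⥤ D} [F.Additive]
    (hF : IsSemilinear R (Localization S) F) {X Y : C} (hfaithful : FaithfulUpTo S F X Y)
    (hfull : FullUpTo (Localization S) S F X Y) :
    ∃ φ : LocalizedModule S (X ⟶ Y) ≃ₗ[Localization S] (F.obj X ⟶ F.obj Y),
      ∀ (f : X ⟶ Y) (s : S), φ (LocalizedModule.mk f s) =
        IsLocalization.mk' (Localization S) (1 : R) s • F.map f := by
  -- `R` acts on the morphisms of `D` through the algebra map.
  let : Module R (F.obj X ⟶ F.obj Y) := Module.compHom _ (algebraMap R (Localization S))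
  have : IsScalarTower R (Localization S) (F.obj X ⟶ F.obj Y) :=
    ⟨fun r s m => by rw [Algebra.smul_def, mul_smul]; rfl⟩
  let l : (X ⟶ Y) →ₗ[R] (F.obj X ⟶ F.obj Y) :=
    { toFun := F.map
      map_add' := fun _ _ => F.map_add
      map_smul' := fun r f => hF f r }
  have hl : IsLocalizedModule S l :=
    { map_units := (isLocalizedModule_id S (F.obj X ⟶ F.obj Y) (Localization S)).map_units
      surj := fun g => by
        obtain ⟨s, hs, f, hf⟩ := hfull g
        exact ⟨(f, ⟨s, hs⟩), hf.symm⟩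
      exists_of_eq := fun {f g} h => by
        obtain ⟨s, hs, h'⟩ := hfaithful (f - g) (by
          rw [F.map_sub, sub_eq_zero]
          exact h)
        exact ⟨⟨s, hs⟩, by rwa [smul_sub, sub_eq_zero] at h'⟩ }
  refine ⟨(IsLocalizedModule.linearEquiv S (LocalizedModule.mkLinearMap S (X ⟶ Y))
    l).extendScalarsOfIsLocalization S (Localization S), fun f s => ?_⟩
  have h : LocalizedModule.mk f s =
      IsLocalization.mk' (Localization S) (1 : R) s • LocalizedModule.mkLinearMap S (X ⟶ Y) f := by
    rw [LocalizedModule.mkLinearMap_apply, ← Localization.mk_eq_mk', LocalizedModule.mk_smul_mk,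
      one_smul, mul_one]
  rw [h, map_smul]
  congr 1
  exact IsLocalizedModule.linearEquiv_apply S (LocalizedModule.mkLinearMap S (X ⟶ Y)) l f

end LocalizedHom

/-! ### Singularity categories -/

section SingularityCategories

variable {R : Type u} [CommRing R] [IsNoetherianRing R] (p : Ideal R) [p.IsPrime]
  [HasDerivedCategory.{w₁} (ModuleCat.{u} R)]
  [HasDerivedCategory.{w₂} (ModuleCat.{u} (Localization.AtPrime p))]

instance : (finiteCohomology R).ι.Linear R where
  map_smul _ _ := rfl

/-- `derivedLocalization` restricts to `dfLocalization`. -/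
noncomputable def dfLocalizationIso : (finiteCohomology R).ι ⋙ derivedLocalization p ≅
    dfLocalization p ⋙ (finiteCohomology (Localization.AtPrime p)).ι :=
  (ObjectProperty.liftCompιIso _ _ _).symm

lemma isSemilinear_dfLocalization :
    IsSemilinear R (Localization.AtPrime p) (dfLocalization p) := fun _ _ f r =>
  (finiteCohomology _).ι.map_injective
    (isSemilinear_derivedLocalization p ((finiteCohomology R).ι.map f) r)

lemma fullyFaithfulUpTo_dfLocalization (X Y : Df R) :
    FullyFaithfulUpTo (Localization.AtPrime p) p.primeCompl (dfLocalization p) X Y :=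
  have h := fullyFaithfulUpTo_derivedLocalization p X.property Y.property
  ⟨.of_square_of_faithful (dfLocalizationIso p) h.1,
    .of_square_of_fullyFaithful (dfLocalizationIso p) h.2⟩

lemma essSurj_dfLocalization : (dfLocalization p).EssSurj where
  mem_essImage Y := by
    obtain ⟨X, hX, ⟨e⟩⟩ := finiteCohomology_le_map p _ Y.property
    exact ⟨⟨X, hX⟩, ⟨ObjectProperty.isoMk _ e⟩⟩

lemma perf_le_map : perf (Localization.AtPrime p) ≤ (perf R).map (dfLocalization p) := by
  intro Y hY
  obtain ⟨X, hX, ⟨e⟩⟩ := perfect_le_map p _ hY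
  exact ⟨⟨X, hX.2⟩, hX.1, ⟨ObjectProperty.isoMk _ e⟩⟩

lemma isSemilinear_dsgLocalization :
    IsSemilinear R (Localization.AtPrime p) (dsgLocalization p) :=
  .of_square (dsgLocalizationIso p) (isSemilinear_dfLocalization p)

/-- `Hom(X, Y)_p ≅ Hom(X_p, Y_p)` in singularity categories. -/
theorem fullyFaithfulUpTo_dsgLocalization (X Y : Dsg R) :
    FullyFaithfulUpTo (Localization.AtPrime p) p.primeCompl (dsgLocalization p) X Y :=
  ⟨.verdierQuotient (dsgLocalizationIso p) (isSemilinear_dfLocalization p)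
      (fun X Y => (fullyFaithfulUpTo_dfLocalization p X Y).1)
      (fun X Y => (fullyFaithfulUpTo_dfLocalization p X Y).2) (perf_le_map p) X Y,
    .verdierQuotient (dsgLocalizationIso p)
      (fun X Y => (fullyFaithfulUpTo_dfLocalization p X Y).2) (perf_le_map p) X Y⟩

lemma essSurj_dsgLocalization : (dsgLocalization p).EssSurj := by
  have := essSurj_dfLocalization p
  have := Functor.essSurj_of_iso (dsgLocalizationIso p).symm
  exact ⟨fun Y => ⟨_, ⟨(VerdierQuotient.quotientFunctor (perf R) ⋙
    dsgLocalization p).objObjPreimageIso Y⟩⟩⟩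

/-- An endomorphism ring vanishing at `p` also vanishes at all smaller primes. -/
lemma supportedOn_primesNotContainedIn_iff {C : Type u} [Category.{v} C] [HasZeroObject C]
    [HasShift C ℤ] [Preadditive C] [∀ n : ℤ, (shiftFunctor C n).Additive] [Pretriangulated C]
    [IsTriangulated C] {R : Type w} [CommRing R] [Linear R C]
    [∀ n : ℤ, (shiftFunctor C n).Linear R] (p : Ideal R) [hp : p.IsPrime] (X : C) :
    supportedOn R C (primesNotContainedIn p) X ↔ ∃ s ∈ p.primeCompl, s • 𝟙 X = 0 := by
  constructor
  · intro h
    exact (subsingleton_localizedModule_end_iff _ X).1 (h ⟨p, hp⟩ (not_not_intro le_rfl))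
  · rintro ⟨s, hs, h⟩ q hq
    exact (subsingleton_localizedModule_end_iff _ X).2
      ⟨s, fun hs' => hs (not_not.1 hq hs'), h⟩

end SingularityCategories

end SingularityCategory

open SingularityCategory in
theorem mainTheorem6 {R : Type u} [CommRing R] [IsNoetherianRing R] (p : Ideal R) [p.IsPrime]
    [HasDerivedCategory.{w₁} (ModuleCat.{u} R)]
    [HasDerivedCategory.{w₂} (ModuleCat.{u} (Localization.AtPrime p))] :
    supportedOn R (Dsg R) (primesNotContainedIn p) =
        (fun X : Dsg R => IsZero ((dsgLocalization p).obj X)) ∧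
    (∃ (F : LocalizationAt (Dsg R) p ⥤ Dsg (Localization.AtPrime p)) (_ : F.CommShift ℤ)
      (e : VerdierQuotient.quotientFunctor (supportedOn R (Dsg R) (primesNotContainedIn p)) ⋙ F ≅
        dsgLocalization p),
      F.IsTriangulated ∧ F.IsEquivalence ∧ NatTrans.CommShift e.hom ℤ) ∧
    (∀ X Y : Dsg R,
      ∃ φ : LocalizedModule p.primeCompl (X ⟶ Y) ≃ₗ[Localization.AtPrime p]
          ((dsgLocalization p).obj X ⟶ (dsgLocalization p).obj Y),
        ∀ (f : X ⟶ Y) (s : p.primeCompl), φ (LocalizedModule.mk f s) =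
          IsLocalization.mk' (Localization.AtPrime p) (1 : R) s • (dsgLocalization p).map f) := by
  have hlin := isSemilinear_dsgLocalization p
  have h := fullyFaithfulUpTo_dsgLocalization p
  have hsupp := supportedOn_primesNotContainedIn_iff (C := Dsg R) p
  refine ⟨?_, ?_, fun X Y => exists_localizedModule_hom_equiv hlin (h X Y).1 (h X Y).2⟩
  · funext X
    exact propext ((hsupp X).trans (isZero_obj_iff_of_faithfulUpTo (R' := Localization.AtPrime p)
      (dsgLocalization p) hlin (fun X Y => (h X Y).1) X).symm)
  · exact exists_equivalence_of_torsionQuotient (dsgLocalization p) hlin (fun X Y => (h X Y).1)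
      (fun X Y => (h X Y).2) (essSurj_dsgLocalization p) _ hsupp
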